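/- **Setting.** An observation is $Z=(X,A,Y)$ with covariates $X$ in a measurable space, real treatment $A$ and real outcome $Y$; its law $P$ is otherwise unrestricted (nonparametric model). $\pi(a|x)$ denotes the conditional density of $A$ given $X=x$ under $P$ (the propensity score, when it exists), $\mu(x,a)=\mathbb E_P[Y\mid X=x,A=a]$ the outcome regression, and $K_h(u)=K(u/h)/h$ with $h>0$ and $K$ a bounded integrable kernel. $S(p,t)$ is a smoothed version of the indicator $\mathbb I(p>t)$; the threshold $t$ is fixed, and $p\mapsto S(p,t)$ is $C^2$ with $|\partial S/\partial\pi|\le L$. For fixed $a$ let $$\psi^{\rm num}_h(a;t;P)=\iint K_h(a_0-a)S(\pi(a_0|x),t)\mu(x,a_0)\,da_0\,dP(x),\qquad \psi^{\rm den}_h(a;t;P)=\iint K_h(a_0-a)S(\pi(a_0|x),t)\,da_0\,dP(x).$$ A regular submodel through $P$ with score $g$ is a family of laws $(P_s)$ with, for $s$ near $0$, $dP_s=r_s\,dP$, $|r_s-1|\le C|s|$ for some constant $C$, and $(r_s-1)/s\to g$ in $L^2(P)$ as $s\to0$. An influence function of a functional $\psi$ at $P$ is a mean-zero $\xi\in L^2(P)$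 with $\frac{d}{ds}\psi(P_s)|_{s=0}=\mathbb E_P[\xi g]$ for every regular submodel; the efficient influence function (EIF) is the one of smallest variance, and $\varphi$ is an uncentered EIF if $\varphi-\psi(P)$ is the EIF. Call $P$ *regular for the numerator* if $\mathbb E_P[Y^2]<\infty$, $\pi(a_0|x)>0$ for almost every $(x,a_0)$ with $K_h(a_0-a)\neq0$, and $\mathbb E_P[\{K_h(A-a)YS(\pi(A|X),t)/\pi(A|X)\}^2]<\infty$. ("Almost every" refers to $da_0\,dP(x)$.) **Theorem.** (i) If $P$ has a propensity score and is regular for the numerator, the uncentered EIF of $\psi^{\rm num}_h(a;t)$ at $P$ is $$\begin{aligned}\varphi^{\rm num}_h(a;t)={}&K_h(A-a)\frac{\{Y-\mu(X,A)\}S(\pi(A|X),t)}{\pi(A|X)}+\int K_h(a_0-a)S(\pi(a_0|X),t)\mu(X,a_0)\,da_0\\&+K_h(A-a)\mu(X,A)\frac{\partial S(\pi(A|X),t)}{\partial\pi}-\int K_h(a_0-a)\mu(X,a_0)\frac{\partial S(\pi(a_0|X),t)}{\partial\pi}\pi(a_0|X)\,da_0 .\end{aligned}$$ (ii) If $P$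 has a propensity score, the uncentered EIF of $\psi^{\rm den}_h(a;t)$ at $P$ is $$\varphi^{\rm den}_h(a;t)=\int K_h(a_0-a)S(\pi(a_0|X),t)\,da_0+K_h(A-a)\frac{\partial S(\pi(A|X),t)}{\partial\pi}-\int K_h(a_0-a)\frac{\partial S(\pi(a_0|X),t)}{\partial\pi}\pi(a_0|X)\,da_0 .$$ (iii) Let $\bar P$ be a second law, with propensity score $\bar\pi$ and outcome regression $\bar\mu$, let $\bar\varphi^{\rm num},\bar\varphi^{\rm den}$ be the functions above with $(\bar\pi,\bar\mu)$ in place of $(\pi,\mu)$, and let $\bar\xi^{\rm num}=\bar\varphi^{\rm num}-\psi^{\rm num}_h(a;t;\bar P)$, $\bar\xi^{\rm den}=\bar\varphi^{\rm den}-\psi^{\rm den}_h(a;t;\bar P)$. Write $\partial_\pi S(\cdot,t)$, $\partial^2_\pi S(\cdot,t)$ for the derivatives of $S$ in its first argument, and $R_3(q,p)=S(p,t)-S(q,t)-\partial_\pi S(q,t)(p-q)-\tfrac12\partial^2_\pi S(q,t)(p-q)^2$. Then the von Mises expansion $$\psi(\bar P)-\psi(P)=\int\bar\xi\,d(\bar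 P-P)+R_2(\bar P,P)$$ holds for the denominator, with $$R_2^{\rm den}=-\iint K_h(a_0-a)\Big[\tfrac12\partial^2_\pi S(\bar\pi,t)(\pi-\bar\pi)^2+R_3(\bar\pi,\pi)\Big]da_0\,dP(x),$$ where the functions in the integrand are evaluated at $(x,a_0)$, whenever $P$ and $\bar P$ have propensity scores. It holds for the numerator, with $$R_2^{\rm num}=\iint K_h(a_0-a)\Big\{\frac{S(\bar\pi,t)}{\bar\pi}-\partial_\pi S(\bar\pi,t)\Big\}(\pi-\bar\pi)(\mu-\bar\mu)\,da_0\,dP(x)-\iint K_h(a_0-a)\,\mu\Big[\tfrac12\partial^2_\pi S(\bar\pi,t)(\pi-\bar\pi)^2+R_3(\bar\pi,\pi)\Big]da_0\,dP(x),$$ if in addition $P$ and $\bar P$ are regular for the numerator, $\bar\pi(a_0|x)>0$ for $da_0\,dP(x)$-almost every $(x,a_0)$ with $K_h(a_0-a)\ne0$, the variables $K_h(A-a)YS(\bar\pi,t)/\bar\pi$, $K_h(A-a)\bar\mu S(\bar\pi,t)/\bar\pi$ and $K_h(A-a)\bar\mu$ (with $\bar\pi,\bar\mu$ evaluated at $(X,A)$)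 are $P$-integrable, and $K_h(a_0-a)S(\bar\pi,t)\bar\mu$, $K_h(a_0-a)\bar\pi\bar\mu$ and $K_h(a_0-a)\bar\pi\mu$ are $da_0\,dP(x)$-integrable. In both cases $\bar\varphi$ is $P$-integrable. (iv) The remainders are of second order. Let $\|f\|^2=\iint|K_h(a_0-a)|f(x,a_0)^2\,da_0\,dP(x)$ and suppose $|\partial^2_\pi S(\cdot,t)|\le B$. Then, in the situation of (iii), $$|R_2^{\rm den}|\le\tfrac B2\|\pi-\bar\pi\|^2 ,$$ and if, for almost every $(x,a_0)$ with $K_h(a_0-a)\neq0$, $\bar\pi\ge c>0$ and $|\mu|\le M$, then $$|R_2^{\rm num}|\le\Big(\frac{|S(0,t)|}{c}+2L\Big)\|\pi-\bar\pi\|\,\|\mu-\bar\mu\|+\frac{BM}2\|\pi-\bar\pi\|^2 .$$ If $S(\cdot,t)$ is $C^3$ with third derivative bounded by $B_3$, then $|R_3(q,p)|\le\frac{B_3}6|p-q|^3$. -/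

import Mathlib

open MeasureTheory ProbabilityTheory Filter Topology
open scoped ENNReal

noncomputable section

namespace TrimmedEffect

variable {𝒳 : Type*} [MeasurableSpace 𝒳]

/-- One observation `Z = (X, A, Y)`: covariates, continuous treatment, outcome. -/
abbrev Obs (𝒳 : Type*) : Type _ := 𝒳 × ℝ × ℝ

/-- The covariates and the treatment `(X, A)` of an observation. -/
def covTreat (z : Obs 𝒳) : 𝒳 × ℝ := (z.1, z.2.1)

/-- The outcome `Y` of an observation. -/
def outcome (z : Obs 𝒳) : ℝ := z.2.2

/-- The marginal law of the covariates `X`. -/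
def covLaw (P : ProbabilityMeasure (Obs 𝒳)) : Measure 𝒳 :=
  (P : Measure (Obs 𝒳)).map Prod.fst

/-- The law of `(X, A)`. -/
def covTreatLaw (P : ProbabilityMeasure (Obs 𝒳)) : Measure (𝒳 × ℝ) :=
  (P : Measure (Obs 𝒳)).map covTreat

/-! ### Efficient influence functions in the nonparametric model -/

section EIF

variable {Z : Type*} [MeasurableSpace Z]

/-- `Q` is a regular one-dimensional submodel through `P` with score `g`: near `s = 0`,
`dQ_s = r_s dP` with `|r_s - 1| ≤ M |s|`, and the likelihood ratio `r_s` is differentiable at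
`s = 0` in `L²(P)` with derivative `g`. For instance `dQ_s = (1 + s g) dP`, for any bounded
measurable `g` with mean zero; so the scores are dense in the mean-zero part of `L²(P)`, that is,
the model is nonparametric. -/
def IsRegularSubmodel (P : ProbabilityMeasure Z) (Q : ℝ → ProbabilityMeasure Z)
    (g : Z → ℝ) : Prop :=
  Measurable g ∧ ∃ (r : ℝ → Z → ℝ) (M : ℝ),
    (∀ᶠ s in 𝓝 (0 : ℝ), Measurable (r s) ∧
      (Q s : Measure Z) = (P : Measure Z).withDensity (fun z => ENNReal.ofReal (r s z)) ∧
      ∀ᵐ z ∂(P : Measure Z), |r s z - 1| ≤ M * |s|) ∧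
    Tendsto (fun s => eLpNorm (fun z => (r s z - 1) / s - g z) 2 (P : Measure Z))
      (𝓝[≠] 0) (𝓝 0)

/-- `ξ` is a (centered) influence function of the functional `ψ` at `P`: it has mean zero and
finite variance, and it represents the pathwise derivative of `ψ` along every regular
submodel. -/
structure IsInfluenceFunction (ψ : ProbabilityMeasure Z → ℝ) (P : ProbabilityMeasure Z)
    (ξ : Z → ℝ) : Prop where
  memLp : MemLp ξ 2 (P : Measure Z)
  mean_zero : ∫ z, ξ z ∂(P : Measure Z) = 0
  pathwise : ∀ (Q : ℝ → ProbabilityMeasure Z) (g : Z → ℝ), IsRegularSubmodel P Q g →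
    HasDerivAt (fun s => ψ (Q s)) (∫ z, ξ z * g z ∂(P : Measure Z)) 0

/-- `ξ` is the (centered) efficient influence function: the influence function of smallest
variance. -/
def IsEfficientIF (ψ : ProbabilityMeasure Z → ℝ) (P : ProbabilityMeasure Z)
    (ξ : Z → ℝ) : Prop :=
  IsInfluenceFunction ψ P ξ ∧
    ∀ ξ' : Z → ℝ, IsInfluenceFunction ψ P ξ' →
      eLpNorm ξ 2 (P : Measure Z) ≤ eLpNorm ξ' 2 (P : Measure Z)

/-- `φ` is the uncentered efficient influence function: `φ - ψ(P)` is the centered one. -/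
def IsUncenteredEIF (ψ : ProbabilityMeasure Z → ℝ) (P : ProbabilityMeasure Z)
    (φ : Z → ℝ) : Prop :=
  IsEfficientIF ψ P (fun z => φ z - ψ P)

end EIF

/-! ### Propensity score and outcome regression -/

/-- `π x a` is (a version of) the propensity score `π(a|x)`: the conditional density of `A` at
`a`, given `X = x`. -/
structure IsPropensityScore (P : ProbabilityMeasure (Obs 𝒳)) (π : 𝒳 → ℝ → ℝ) : Prop where
  measurable : Measurable (fun w : 𝒳 × ℝ => π w.1 w.2)
  nonneg : ∀ x a, 0 ≤ π x a
  lintegral_eq_one : ∀ x, ∫⁻ a, ENNReal.ofReal (π x a) = 1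
  law : covTreatLaw P =
    ((covLaw P).prod volume).withDensity (fun w => ENNReal.ofReal (π w.1 w.2))

/-- `μ x a` is (a version of) the outcome regression `μ(x, a) = E[Y | X = x, A = a]`. -/
structure IsOutcomeRegression (P : ProbabilityMeasure (Obs 𝒳)) (μ : 𝒳 → ℝ → ℝ) : Prop where
  measurable : Measurable (fun w : 𝒳 × ℝ => μ w.1 w.2)
  integrable : Integrable outcome (P : Measure (Obs 𝒳))
  condExp : (fun z : Obs 𝒳 => μ z.1 z.2.1) =ᵐ[(P : Measure (Obs 𝒳))]
    (P : Measure (Obs 𝒳))[outcome | MeasurableSpace.comap covTreat inferInstance]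

/-- The version of the propensity score that is used in the definition of the estimands. -/
def propScore (P : ProbabilityMeasure (Obs 𝒳)) (x : 𝒳) (a : ℝ) : ℝ :=
  ((covTreatLaw P).rnDeriv ((covLaw P).prod volume) (x, a)).toReal

/-- The version of the outcome regression that is used in the definition of the estimands. -/
def outReg (P : ProbabilityMeasure (Obs 𝒳)) (x : 𝒳) (a : ℝ) : ℝ :=
  ∫ y, y ∂(condDistrib outcome covTreat (P : Measure (Obs 𝒳)) (x, a))

/-! ### Kernel and smoothed trimming indicator -/

/-- The scaled kernel `K_h(u) = K(u / h) / h`. -/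
def scaledKernel (K : ℝ → ℝ) (h u : ℝ) : ℝ := K (u / h) / h

/-- A (possibly signed) bounded integrable kernel. -/
structure IsKernel (K : ℝ → ℝ) : Prop where
  measurable : Measurable K
  bounded : ∃ B, ∀ u, |K u| ≤ B
  integrable : Integrable K

/-- `∂S(p, t)/∂p`. -/
def dS (S : ℝ → ℝ → ℝ) (t p : ℝ) : ℝ := deriv (fun q => S q t) p

/-- `∂²S(p, t)/∂p²`. -/
def ddS (S : ℝ → ℝ → ℝ) (t p : ℝ) : ℝ := deriv (dS S t) p

/-- The remainder, beyond second order, of the Taylor expansion of `S(·, t)` around `q`, at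
`p`. -/
def taylorR3 (S : ℝ → ℝ → ℝ) (t q p : ℝ) : ℝ :=
  S p t - (S q t + dS S t q * (p - q) + 1 / 2 * ddS S t q * (p - q) ^ 2)

/-- The measure `|K_h(a₀ - a)| da₀ dP(x)`. -/
def kernelMeasure (K : ℝ → ℝ) (h a : ℝ) (P : ProbabilityMeasure (Obs 𝒳)) : Measure (𝒳 × ℝ) :=
  ((covLaw P).prod volume).withDensity (fun w => ENNReal.ofReal |scaledKernel K h (w.2 - a)|)

/-- The norm `‖f - g‖`, where `‖f‖² = ∫∫ |K_h(a₀ - a)| f(x, a₀)² da₀ dP(x)`. -/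
def kernelDist (K : ℝ → ℝ) (h a : ℝ) (P : ProbabilityMeasure (Obs 𝒳))
    (f g : 𝒳 → ℝ → ℝ) : ℝ≥0∞ :=
  eLpNorm (fun w : 𝒳 × ℝ => f w.1 w.2 - g w.1 w.2) 2 (kernelMeasure K h a P)

/-! ### Estimands and influence functions -/

/-- `ψ_h^num(a; t) = ∫∫ K_h(a₀ - a) S(π(a₀|x), t) μ(x, a₀) da₀ dP(x)`, as a functional of `P`. -/
def psiNum (K : ℝ → ℝ) (h a : ℝ) (S : ℝ → ℝ → ℝ) (t : ℝ)
    (P : ProbabilityMeasure (Obs 𝒳)) : ℝ :=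
  ∫ x, (∫ a₀, scaledKernel K h (a₀ - a) * S (propScore P x a₀) t * outReg P x a₀) ∂(covLaw P)

/-- `ψ_h^den(a; t) = ∫∫ K_h(a₀ - a) S(π(a₀|x), t) da₀ dP(x)`, as a functional of `P`. -/
def psiDen (K : ℝ → ℝ) (h a : ℝ) (S : ℝ → ℝ → ℝ) (t : ℝ)
    (P : ProbabilityMeasure (Obs 𝒳)) : ℝ :=
  ∫ x, (∫ a₀, scaledKernel K h (a₀ - a) * S (propScore P x a₀) t) ∂(covLaw P)

/-- `φ_h^num(a; t)` with nuisance functions `π` and `μ`. -/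
def phiNum (K : ℝ → ℝ) (h a : ℝ) (S : ℝ → ℝ → ℝ) (t : ℝ) (π μ : 𝒳 → ℝ → ℝ) :
    Obs 𝒳 → ℝ
  | (X, A, Y) =>
    scaledKernel K h (A - a) * ((Y - μ X A) * S (π X A) t / π X A)
      + (∫ a₀, scaledKernel K h (a₀ - a) * S (π X a₀) t * μ X a₀)
      + scaledKernel K h (A - a) * μ X A * dS S t (π X A)
      - ∫ a₀, scaledKernel K h (a₀ - a) * μ X a₀ * dS S t (π X a₀) * π X a₀

/-- `φ_h^den(a; t)` with nuisance function `π`. -/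
def phiDen (K : ℝ → ℝ) (h a : ℝ) (S : ℝ → ℝ → ℝ) (t : ℝ) (π : 𝒳 → ℝ → ℝ) :
    Obs 𝒳 → ℝ
  | (X, A, _) =>
    (∫ a₀, scaledKernel K h (a₀ - a) * S (π X a₀) t)
      + scaledKernel K h (A - a) * dS S t (π X A)
      - ∫ a₀, scaledKernel K h (a₀ - a) * dS S t (π X a₀) * π X a₀

/-- Conditions under which `ψ_h^num(a; t)` is identified at `P` and its influence function has
finite variance: `Y` has a second moment, the propensity score is positive where
`K_h(a₀ - a) ≠ 0` (almost everywhere), and the inverse-weighted outcome has a second moment. -/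
structure NumRegular (K : ℝ → ℝ) (h a : ℝ) (S : ℝ → ℝ → ℝ) (t : ℝ)
    (P : ProbabilityMeasure (Obs 𝒳)) (π : 𝒳 → ℝ → ℝ) : Prop where
  outcome_memLp : MemLp outcome 2 (P : Measure (Obs 𝒳))
  positivity : ∀ᵐ w ∂(kernelMeasure K h a P), 0 < π w.1 w.2
  weighted_memLp : MemLp
    (fun z : Obs 𝒳 => scaledKernel K h (z.2.1 - a) * z.2.2 * S (π z.1 z.2.1) t / π z.1 z.2.1) 2
    (P : Measure (Obs 𝒳))

/-- The influence function of `ψ_h^num(a; t)` with nuisance functions `π'` and `μ'` has a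
well-defined mean under `P`, whose outcome regression is `μ`: `π'` is positive where
`K_h(a₀ - a) ≠ 0`, and the integrals involved converge. -/
structure CrossIntegrable (K : ℝ → ℝ) (h a : ℝ) (S : ℝ → ℝ → ℝ) (t : ℝ)
    (P : ProbabilityMeasure (Obs 𝒳)) (μ π' μ' : 𝒳 → ℝ → ℝ) : Prop where
  positivity : ∀ᵐ w ∂(kernelMeasure K h a P), 0 < π' w.1 w.2
  weighted_outcome : Integrable (fun z : Obs 𝒳 =>
    scaledKernel K h (z.2.1 - a) * z.2.2 * S (π' z.1 z.2.1) t / π' z.1 z.2.1)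
    (P : Measure (Obs 𝒳))
  weighted_regression : Integrable (fun z : Obs 𝒳 =>
    scaledKernel K h (z.2.1 - a) * μ' z.1 z.2.1 * S (π' z.1 z.2.1) t / π' z.1 z.2.1)
    (P : Measure (Obs 𝒳))
  regression : Integrable (fun z : Obs 𝒳 => scaledKernel K h (z.2.1 - a) * μ' z.1 z.2.1)
    (P : Measure (Obs 𝒳))
  trimmed : Integrable (fun w : 𝒳 × ℝ => S (π' w.1 w.2) t * μ' w.1 w.2) (kernelMeasure K h a P)
  product : Integrable (fun w : 𝒳 × ℝ => π' w.1 w.2 * μ' w.1 w.2) (kernelMeasure K h a P)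
  cross_product : Integrable (fun w : 𝒳 × ℝ => π' w.1 w.2 * μ w.1 w.2) (kernelMeasure K h a P)

/-! ### Remainders of the von Mises expansions -/

/-- The remainder `R₂^den(P', P)`, where `π` and `π'` are the propensity scores under `P` and
`P'`. -/
def remDen (K : ℝ → ℝ) (h a : ℝ) (S : ℝ → ℝ → ℝ) (t : ℝ)
    (P : ProbabilityMeasure (Obs 𝒳)) (π π' : 𝒳 → ℝ → ℝ) : ℝ :=
  -∫ x, (∫ a₀, scaledKernel K h (a₀ - a) *
    (1 / 2 * ddS S t (π' x a₀) * (π x a₀ - π' x a₀) ^ 2 + taylorR3 S t (π' x a₀) (π x a₀)))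
    ∂(covLaw P)

/-- The remainder `R₂^num(P', P)`, where `π, μ` and `π', μ'` are the propensity scores and
outcome regressions under `P` and `P'`. -/
def remNum (K : ℝ → ℝ) (h a : ℝ) (S : ℝ → ℝ → ℝ) (t : ℝ)
    (P : ProbabilityMeasure (Obs 𝒳)) (π μ π' μ' : 𝒳 → ℝ → ℝ) : ℝ :=
  (∫ x, (∫ a₀, scaledKernel K h (a₀ - a) *
    (S (π' x a₀) t / π' x a₀ - dS S t (π' x a₀)) *
      (π x a₀ - π' x a₀) * (μ x a₀ - μ' x a₀)) ∂(covLaw P))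
  - ∫ x, (∫ a₀, scaledKernel K h (a₀ - a) * μ x a₀ *
    (1 / 2 * ddS S t (π' x a₀) * (π x a₀ - π' x a₀) ^ 2 + taylorR3 S t (π' x a₀) (π x a₀)))
    ∂(covLaw P)

end TrimmedEffect

end

noncomputable section

namespace TrimmedEffect

/-! ### Taylor bounds -/

/-! Everything rests on one exact identity. For arbitrary nuisances `π'`, `μ'` subject to
integrability, the mean under `P` of the uncentered influence function built from `π'`, `μ'` equals
`ψ(P)` plus the stated remainder (`integrable_phiNum_and_integral`,
`integrable_phiDen_and_integral`). One integrates out `Y` by the tower property and `A` by its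
density; what is left over `da₀ dP(x)` factors algebraically into a product of the errors in `π` and
`μ` and a first-order Taylor remainder of `S`.

With the true nuisances the remainder vanishes, so `φ` has mean `ψ(P)`. Using the identity once
under `P'` with its own nuisances and once under `P` with those of `P'` gives the von Mises
expansion. The quantitative bounds are then Cauchy–Schwarz for the kernel-weighted measure
(`ofReal_abs_integral_le`) and Taylor bounds for `S`.

For the pathwise derivative the roles are exchanged: the nuisances stay at `P` and the mean is taken
under `Q s`. Then `ψ (Q s)` is `∫ φ dQ_s` minus a remainder. The first term has derivative `E[ξ g]`
by Cauchy–Schwarz (`hasDerivAt_integral_of_likelihood`). The remainder is `o(s)`: a likelihood ratio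
within `O(s)` of one moves the propensity score by a relative `O(s)` (`IsTilt.abs_propScore_sub_le`)
and the outcome regression by `O(s)` in weighted mean (`IsTilt.integral_abs_outReg_sub_le`), so the
product term is `O(s²)`. The Taylor term is `o(s)` by dominated convergence
(`isLittleO_integral_taylorR2`), for which a bound on the first derivative of `S` suffices.

Efficiency costs nothing: centred indicators are scores, and they determine an influence function
almost everywhere (`IsInfluenceFunction.ae_eq`). -/

/-- A function that vanishes at `q` and whose derivative is `O(|x - q|ⁿ)` is `O(|x - q|ⁿ⁺¹)`, with
the constant that integration gives: the case of a point to the right of `q`. -/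
theorem abs_le_of_abs_deriv_le_right {f f' : ℝ → ℝ} {q C : ℝ} {n : ℕ}
    (hf : ∀ x, HasDerivAt f (f' x) x) (h0 : f q = 0) (hC : ∀ x, |f' x| ≤ C * |x - q| ^ n)
    {p : ℝ} (hp : q ≤ p) : |f p| ≤ C / (n + 1) * |p - q| ^ (n + 1) := by
  have hB : ∀ x, HasDerivAt (fun x => C / (n + 1) * (x - q) ^ (n + 1)) (C * (x - q) ^ n) x := by
    intro x
    have := (((hasDerivAt_id x).sub_const q).pow (n + 1)).const_mul (C / ((n : ℝ) + 1))
    refine this.congr_deriv ?_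
    simp only [id, Nat.add_sub_cancel]
    push_cast
    have : (n : ℝ) + 1 ≠ 0 := by positivity
    field_simp
  have h := image_norm_le_of_norm_deriv_right_le_deriv_boundary (f := f) (f' := f') (a := q)
    (b := p) (fun x _ => (hf x).continuousAt.continuousWithinAt)
    (fun x _ => (hf x).hasDerivWithinAt) (B := fun x => C / (n + 1) * (x - q) ^ (n + 1))
    (B' := fun x => C * (x - q) ^ n) (by simp [h0])
    hB
    (fun x hx => by
      have := hC x
      rwa [abs_of_nonneg (sub_nonneg.2 hx.1)] at this) (Set.right_mem_Icc.2 hp)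
  rwa [abs_of_nonneg (sub_nonneg.2 hp)]

theorem abs_le_of_abs_deriv_le {f f' : ℝ → ℝ} {q C : ℝ} {n : ℕ}
    (hf : ∀ x, HasDerivAt f (f' x) x) (h0 : f q = 0) (hC : ∀ x, |f' x| ≤ C * |x - q| ^ n)
    (p : ℝ) : |f p| ≤ C / (n + 1) * |p - q| ^ (n + 1) := by
  rcases le_total q p with hp | hp
  · exact abs_le_of_abs_deriv_le_right hf h0 hC hp
  -- A point to the left of `q` is handled by the reflection `x ↦ -x`.
  · have h := abs_le_of_abs_deriv_le_right (f := fun x => f (-x)) (f' := fun x => -f' (-x))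
      (q := -q) (C := C) (n := n) (p := -p) (fun x => by
        have := (hf (-x)).comp x (hasDerivAt_neg x)
        exact this.congr_deriv (by ring)) (by simp [h0])
      (fun x => by
        rw [abs_neg]
        refine (hC (-x)).trans_eq ?_
        rw [← abs_neg (-x - q)]
        congr 3
        ring) (by linarith)
    have e : |(-p) - (-q)| = |p - q| := by rw [← abs_neg]; congr 1; ring
    rw [e] at h
    simpa using h

/-! ### Taylor estimates for the smoothed indicator. -/

section Smoothing

variable {S : ℝ → ℝ → ℝ} {t : ℝ}

theorem hasDerivAt_dS (hS : ContDiff ℝ 2 (fun p => S p t)) (p : ℝ) :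
    HasDerivAt (fun p => S p t) (dS S t p) p :=
  ((hS.differentiable (by norm_num)) p).hasDerivAt

theorem contDiff_dS (hS : ContDiff ℝ 2 (fun p => S p t)) : ContDiff ℝ 1 (dS S t) :=
  ((contDiff_succ_iff_deriv (n := 1)).1 (by simpa [one_add_one_eq_two] using hS)).2.2

theorem continuous_dS (hS : ContDiff ℝ 2 (fun p => S p t)) : Continuous (dS S t) :=
  (contDiff_dS hS).continuous

theorem hasDerivAt_ddS (hS : ContDiff ℝ 2 (fun p => S p t)) (p : ℝ) :
    HasDerivAt (dS S t) (ddS S t p) p :=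
  (((contDiff_dS hS).differentiable (by norm_num)) p).hasDerivAt

theorem abs_sub_le_of_abs_dS_le (hS : ContDiff ℝ 2 (fun p => S p t)) {L : ℝ}
    (hL : ∀ p, |dS S t p| ≤ L) (p q : ℝ) : |S p t - S q t| ≤ L * |p - q| := by
  have h := abs_le_of_abs_deriv_le (f := fun x => S x t - S q t) (f' := dS S t) (q := q) (C := L)
    (n := 0) (fun x => (hasDerivAt_dS hS x).sub_const _) (by simp) (fun x => by simpa using hL x) p
  simpa using h

/-- The remainder, beyond first order, of the Taylor expansion of `S(·, t)` around `q`, at `p`. -/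
def taylorR2 (S : ℝ → ℝ → ℝ) (t q p : ℝ) : ℝ := S p t - S q t - dS S t q * (p - q)

/-- The second derivative cancels: the bracket in both remainders is just the first-order Taylor
remainder. The expansions are therefore proved with `taylorR2`, and `ddS` matters only for the
quantitative bounds. -/
theorem half_ddS_add_taylorR3 (q p : ℝ) :
    1 / 2 * ddS S t q * (p - q) ^ 2 + taylorR3 S t q p = taylorR2 S t q p := by
  simp only [taylorR3, taylorR2]; ring

/-- Linear rather than quadratic, but free of any bound on the second derivative. It supplies
integrability and domination where only `L` is available. -/
theorem abs_taylorR2_le_lipschitz (hS : ContDiff ℝ 2 (fun p => S p t)) {L : ℝ}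
    (hL : ∀ p, |dS S t p| ≤ L) (q p : ℝ) : |taylorR2 S t q p| ≤ 2 * L * |p - q| := by
  have h1 := abs_sub_le_of_abs_dS_le hS hL p q
  have h2 : |dS S t q * (p - q)| ≤ L * |p - q| := by
    rw [abs_mul]; exact mul_le_mul_of_nonneg_right (hL q) (abs_nonneg _)
  have h3 := abs_sub (S p t - S q t) (dS S t q * (p - q))
  unfold taylorR2
  linarith

/-- As a function of `p`, the remainder has derivative `dS S t p - dS S t q`, which is
`B`-Lipschitz; integrating once more gives `B / 2`. -/
theorem abs_taylorR2_le (hS : ContDiff ℝ 2 (fun p => S p t)) {B : ℝ}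
    (hB : ∀ p, |ddS S t p| ≤ B) (q p : ℝ) : |taylorR2 S t q p| ≤ B / 2 * (p - q) ^ 2 := by
  have h1 : ∀ x, |dS S t x - dS S t q| ≤ B * |x - q| ^ 1 := fun x => by
    have h := abs_le_of_abs_deriv_le (f := fun x => dS S t x - dS S t q) (f' := ddS S t) (q := q)
      (C := B) (n := 0) (fun x => (hasDerivAt_ddS hS x).sub_const _) (by simp)
      (fun x => by simpa using hB x) x
    simpa using h
  have h := abs_le_of_abs_deriv_le (f := fun x => taylorR2 S t q x)
    (f' := fun x => dS S t x - dS S t q) (q := q) (C := B) (n := 1)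
    (fun x => by
      have := ((hasDerivAt_dS hS x).sub_const (S q t)).sub
        (((hasDerivAt_id x).sub_const q).const_mul (dS S t q))
      exact this.congr_deriv (by simp)) (by simp [taylorR2]) h1 p
  have e : (1 : ℝ) + 1 = 2 := by norm_num
  simpa [sq_abs, e] using h

/-- Three successive integrations from `q` turn the bound on the third derivative into the constants
`B`, `B / 2` and `B / 6`. -/
theorem abs_taylorR3_le (hS : ContDiff ℝ 3 (fun p => S p t)) {B : ℝ}
    (hB : ∀ p, |deriv (ddS S t) p| ≤ B) (q p : ℝ) :
    |taylorR3 S t q p| ≤ B / 6 * |p - q| ^ 3 := by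
  have hS2 : ContDiff ℝ 2 (fun p => S p t) := hS.of_le (by norm_num)
  have hd : ContDiff ℝ 2 (dS S t) :=
    ((contDiff_succ_iff_deriv (n := 2)).1 (by simpa [two_add_one_eq_three] using hS)).2.2
  have hdd : ContDiff ℝ 1 (ddS S t) :=
    ((contDiff_succ_iff_deriv (n := 1)).1 (by simpa [one_add_one_eq_two] using hd)).2.2
  have h0 : ∀ x, |ddS S t x - ddS S t q| ≤ B * |x - q| ^ 1 := fun x => by
    have h := abs_le_of_abs_deriv_le (f := fun x => ddS S t x - ddS S t q)
      (f' := deriv (ddS S t)) (q := q) (C := B) (n := 0)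
      (fun x => ((hdd.differentiable (by norm_num)) x).hasDerivAt.sub_const _) (by simp)
      (fun x => by simpa using hB x) x
    simpa using h
  have h1 : ∀ x, |dS S t x - dS S t q - ddS S t q * (x - q)| ≤ B / 2 * |x - q| ^ 2 := fun x => by
    have h := abs_le_of_abs_deriv_le (f := fun x => dS S t x - dS S t q - ddS S t q * (x - q))
      (f' := fun x => ddS S t x - ddS S t q) (q := q) (C := B) (n := 1)
      (fun x => by
        have := ((hasDerivAt_ddS hS2 x).sub_const (dS S t q)).sub
          (((hasDerivAt_id x).sub_const q).const_mul (ddS S t q))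
        exact this.congr_deriv (by simp)) (by simp) h0 x
    have e : (1 : ℝ) + 1 = 2 := by norm_num
    simpa [e] using h
  have h := abs_le_of_abs_deriv_le (f := fun x => taylorR3 S t q x)
    (f' := fun x => dS S t x - dS S t q - ddS S t q * (x - q)) (q := q) (C := B / 2) (n := 2)
    (fun x => by
      have := (hasDerivAt_dS hS2 x).sub ((((hasDerivAt_id x).sub_const q).const_mul
        (dS S t q)).const_add (S q t) |>.add
          ((((hasDerivAt_id x).sub_const q).pow 2).const_mul (1 / 2 * ddS S t q)))
      exact this.congr_deriv (by simp; ring)) (by simp [taylorR3]) h1 p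
  convert h using 2
  push_cast
  ring

end Smoothing

/-! ### Influence functions in the nonparametric model -/

section EIF

variable {Z : Type*} [MeasurableSpace Z] {P : ProbabilityMeasure Z}

/-- The linear tilt `(1 + s g) dP` by a bounded mean-zero score `g` is a regular
submodel. -/
theorem exists_isRegularSubmodel {g : Z → ℝ} (hg : Measurable g) (hb : ∀ z, |g z| ≤ 1)
    (h0 : ∫ z, g z ∂(P : Measure Z) = 0) :
    ∃ Q : ℝ → ProbabilityMeasure Z, IsRegularSubmodel P Q g := by
  have hgi : Integrable g (P : Measure Z) :=
    Integrable.of_bound hg.aestronglyMeasurable 1 (ae_of_all _ hb)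
  have key : ∀ s : ℝ, |s| ≤ 1 → IsProbabilityMeasure
      ((P : Measure Z).withDensity (fun z => ENNReal.ofReal (1 + s * g z))) := by
    intro s hs
    constructor
    rw [withDensity_apply _ MeasurableSet.univ, setLIntegral_univ, ← ofReal_integral_eq_lintegral_ofReal]
    · rw [integral_add (integrable_const _) (hgi.const_mul _), integral_const_mul, h0]
      simp
    · exact (integrable_const _).add (hgi.const_mul _)
    · refine ae_of_all _ fun z => ?_
      have : |s * g z| ≤ 1 := by
        rw [abs_mul]; exact mul_le_one₀ hs (abs_nonneg _) (hb z)
      have := (abs_le.1 this).1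
      show 0 ≤ 1 + s * g z
      linarith
  classical
  -- For `|s| > 1` the tilt may fail to be nonnegative. Only small `s` matter, so any law, here `P`,
  -- serves there.
  refine ⟨fun s => if h : |s| ≤ 1 then ⟨_, key s h⟩ else P, hg, fun s z => 1 + s * g z, 1, ?_, ?_⟩
  · have : ∀ᶠ s in 𝓝 (0 : ℝ), |s| ≤ 1 := by
      filter_upwards [Metric.closedBall_mem_nhds (0 : ℝ) one_pos] with s hs
      simpa using hs
    filter_upwards [this] with s hs
    refine ⟨by fun_prop, ?_, ae_of_all _ fun z => ?_⟩
    · simp [hs]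
    · simp only [add_sub_cancel_left, abs_mul, one_mul]
      exact mul_le_of_le_one_right (abs_nonneg _) (hb z)
  · refine tendsto_const_nhds.congr' ?_
    filter_upwards [self_mem_nhdsWithin] with s hs
    have : (fun z => (1 + s * g z - 1) / s - g z) = 0 := by
      ext z
      have : s ≠ 0 := hs
      simp [this]
    rw [this, eLpNorm_zero]

/-- In the nonparametric model there is only one influence function. -/
theorem IsInfluenceFunction.ae_eq {ψ : ProbabilityMeasure Z → ℝ} {ξ ξ' : Z → ℝ}
    (h : IsInfluenceFunction ψ P ξ) (h' : IsInfluenceFunction ψ P ξ') :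
    ξ =ᵐ[(P : Measure Z)] ξ' := by
  have hi := h.memLp.integrable (by norm_num)
  have hi' := h'.memLp.integrable (by norm_num)
  -- Test against the score `1_A - P(A)`: since `ξ` has mean zero, `E[ξ g]` is the integral of `ξ`
  -- over `A`. Both influence functions thus have the same integral over every measurable set.
  have := (hi.sub hi').ae_eq_zero_of_forall_setIntegral_eq_zero fun A hA _ => by
    set c : ℝ := (P : Measure Z).real A
    set g : Z → ℝ := fun z => A.indicator (fun _ => (1 : ℝ)) z - c with hg
    have hc0 : 0 ≤ c := measureReal_nonneg
    have hc1 : c ≤ 1 := measureReal_le_one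
    have hgm : Measurable g := (measurable_const.indicator hA).sub_const c
    have hgb : ∀ z, |g z| ≤ 1 := fun z => by
      by_cases hz : z ∈ A <;> simp only [hg, hz, Set.indicator_of_mem, Set.indicator_of_notMem,
        not_false_eq_true, abs_le] <;> constructor <;> linarith
    have hg0 : ∫ z, g z ∂(P : Measure Z) = 0 := by
      rw [hg, integral_sub ((integrable_const _).indicator hA) (integrable_const _),
        integral_indicator_const _ hA]
      simp [c]
    obtain ⟨Q, hQ⟩ := exists_isRegularSubmodel hgm hgb hg0
    have he := (h.pathwise Q g hQ).unique (h'.pathwise Q g hQ)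
    have aux : ∀ ξ : Z → ℝ, Integrable ξ (P : Measure Z) → ∫ z, ξ z ∂(P : Measure Z) = 0 →
        ∫ z, ξ z * g z ∂(P : Measure Z) = ∫ z in A, ξ z ∂(P : Measure Z) := by
      intro ξ hξ hξ0
      have e : (fun z => ξ z * g z) = fun z => A.indicator ξ z - ξ z * c := by
        ext z
        by_cases hz : z ∈ A <;> simp [hg, hz, mul_sub]
      rw [e, integral_sub (hξ.indicator hA) (hξ.mul_const _), integral_indicator hA,
        integral_mul_const, hξ0]
      simp
    rw [aux ξ hi h.mean_zero, aux ξ' hi' h'.mean_zero] at he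
    simp only [Pi.sub_apply]
    rw [integral_sub hi.integrableOn hi'.integrableOn, he, sub_self]
  filter_upwards [this] with z hz
  simpa [sub_eq_zero] using hz

/-- Minimality of the variance is automatic, because any competitor is almost everywhere equal. -/
theorem IsInfluenceFunction.isEfficientIF {ψ : ProbabilityMeasure Z → ℝ} {ξ : Z → ℝ}
    (h : IsInfluenceFunction ψ P ξ) : IsEfficientIF ψ P ξ :=
  ⟨h, fun _ h' => (eLpNorm_congr_ae (h.ae_eq h')).le⟩

/-- `Q` has a likelihood ratio with respect to `P` that is within `ε` of one. -/
structure IsTilt (P Q : ProbabilityMeasure Z) (r : Z → ℝ) (ε : ℝ) : Prop where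
  measurable : Measurable r
  eq : (Q : Measure Z) = (P : Measure Z).withDensity (fun z => ENNReal.ofReal (r z))
  bound : ∀ᵐ z ∂(P : Measure Z), |r z - 1| ≤ ε

theorem IsTilt.integral_eq {Q : ProbabilityMeasure Z} {r : Z → ℝ} {ε : ℝ} (h : IsTilt P Q r ε)
    (hε : ε ≤ 1) (f : Z → ℝ) :
    ∫ z, f z ∂(Q : Measure Z) = ∫ z, r z * f z ∂(P : Measure Z) := by
  rw [h.eq, integral_withDensity_eq_integral_toReal_smul h.measurable.ennreal_ofReal (by simp)]
  refine integral_congr_ae ?_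
  filter_upwards [h.bound] with z hz
  -- With `ε ≤ 1` the likelihood ratio is nonnegative, so `ENNReal.ofReal` truncates nothing.
  have := (abs_le.1 hz).1
  rw [ENNReal.toReal_ofReal (by linarith), smul_eq_mul]

/-- The likelihood ratio is used below mostly through this comparison of measures and its converse
`IsTilt.smul_le`. Unlike a density, the comparison passes at once to images and products, hence to
the laws of `X` and `(X, A)` and to `da₀ dP(x)`. -/
theorem IsTilt.le_smul {Q : ProbabilityMeasure Z} {r : Z → ℝ} {ε : ℝ} (h : IsTilt P Q r ε) :
    (Q : Measure Z) ≤ ENNReal.ofReal (1 + ε) • (P : Measure Z) := by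
  rw [h.eq, ← withDensity_const]
  refine withDensity_mono ?_
  filter_upwards [h.bound] with z hz
  have := (abs_le.1 hz).2
  exact ENNReal.ofReal_le_ofReal (by linarith)

theorem IsTilt.smul_le {Q : ProbabilityMeasure Z} {r : Z → ℝ} {ε : ℝ} (h : IsTilt P Q r ε) :
    ENNReal.ofReal (1 - ε) • (P : Measure Z) ≤ Q := by
  rw [h.eq, ← withDensity_const]
  refine withDensity_mono ?_
  filter_upwards [h.bound] with z hz
  have := (abs_le.1 hz).1
  exact ENNReal.ofReal_le_ofReal (by linarith)

/-- Along a regular submodel, the mean of a fixed square-integrable mean-zero variable `ξ` has the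
derivative `E[ξ g]`. -/
theorem hasDerivAt_integral_of_likelihood {Q : ℝ → ProbabilityMeasure Z} {g ξ : Z → ℝ}
    {r : ℝ → Z → ℝ} {M : ℝ} (hg : Measurable g)
    (hr : ∀ᶠ s in 𝓝 (0 : ℝ), IsTilt P (Q s) (r s) (M * |s|))
    (hlim : Tendsto (fun s => eLpNorm (fun z => (r s z - 1) / s - g z) 2 (P : Measure Z))
      (𝓝[≠] 0) (𝓝 0))
    (hξ : MemLp ξ 2 (P : Measure Z)) :
    HasDerivAt (fun s => ∫ z, ξ z ∂(Q s : Measure Z)) (∫ z, ξ z * g z ∂(P : Measure Z)) 0 := by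
  have hsmall : ∀ᶠ s in 𝓝 (0 : ℝ), M * |s| ≤ 1 := by
    have : Tendsto (fun s : ℝ => M * |s|) (𝓝 0) (𝓝 (M * |0|)) := by
      apply Continuous.tendsto; fun_prop
    exact this.eventually_le_const (by simp)
  have hξi := hξ.integrable (by norm_num)
  -- At `s = 0` the bound `M * |s|` is zero, so the likelihood ratio is one almost everywhere.
  have h0 : ∫ z, ξ z ∂(Q 0 : Measure Z) = ∫ z, ξ z ∂(P : Measure Z) := by
    have h := hr.self_of_nhds
    rw [h.integral_eq (by simp)]
    refine integral_congr_ae ?_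
    filter_upwards [h.bound] with z hz
    have : r 0 z - 1 = 0 := by simpa using hz
    rw [sub_eq_zero.1 this, one_mul]
  rw [hasDerivAt_iff_tendsto_slope, tendsto_iff_norm_sub_tendsto_zero]
  have hlim' : Tendsto (fun s => (eLpNorm ξ 2 (P : Measure Z) *
      eLpNorm (fun z => (r s z - 1) / s - g z) 2 (P : Measure Z)).toReal) (𝓝[≠] 0) (𝓝 0) := by
    have := (ENNReal.tendsto_toReal (by simp)).comp
      (ENNReal.Tendsto.const_mul hlim (Or.inr hξ.eLpNorm_ne_top))
    simpa only [mul_zero, ENNReal.toReal_zero, Function.comp_def] using this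
  have hfin : ∀ᶠ s in 𝓝[≠] (0 : ℝ),
      eLpNorm (fun z => (r s z - 1) / s - g z) 2 (P : Measure Z) < ⊤ :=
    hlim.eventually_lt_const (by simp)
  refine squeeze_zero' (Eventually.of_forall fun _ => norm_nonneg _) ?_ hlim'
  filter_upwards [hr.filter_mono nhdsWithin_le_nhds, hsmall.filter_mono nhdsWithin_le_nhds, hfin,
    self_mem_nhdsWithin] with s hs hs1 hsf hs0
  have hs0 : s ≠ 0 := hs0
  -- `d` is the error of the difference quotient of the likelihood ratio. The slope misses its limit
  -- by exactly `E[ξ d]`, which Cauchy–Schwarz controls.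
  set d : Z → ℝ := fun z => (r s z - 1) / s - g z with hd
  have hdm : Measurable d := ((hs.measurable.sub_const 1).div_const s).sub hg
  have hdL : MemLp d 2 (P : Measure Z) := ⟨hdm.aestronglyMeasurable, hsf⟩
  have hqL : MemLp (fun z => (r s z - 1) / s) ⊤ (P : Measure Z) := by
    refine memLp_top_of_bound ((hs.measurable.sub_const 1).div_const s).aestronglyMeasurable M ?_
    filter_upwards [hs.bound] with z hz
    rw [Real.norm_eq_abs, abs_div, div_le_iff₀ (abs_pos.2 hs0)]
    exact hz
  have hqL2 : MemLp (fun z => (r s z - 1) / s) 2 (P : Measure Z) := hqL.mono_exponent le_top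
  -- Square integrability of the score is not assumed: `g` is the difference of a bounded quotient
  -- and of `d`, whose norm is finite for small `s`.
  have hgL : MemLp g 2 (P : Measure Z) := by
    have := hqL2.sub hdL
    convert this using 1
    ext z; simp [hd]
  have hi1 : Integrable (fun z => ξ z * ((r s z - 1) / s)) (P : Measure Z) :=
    hξ.integrable_mul hqL2
  have hi2 : Integrable (fun z => ξ z * g z) (P : Measure Z) := hξ.integrable_mul hgL
  have e : slope (fun s => ∫ z, ξ z ∂(Q s : Measure Z)) 0 s - ∫ z, ξ z * g z ∂(P : Measure Z)
      = ∫ z, ξ z * d z ∂(P : Measure Z) := by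
    have e1 : (fun z => ξ z * d z) = fun z => ξ z * ((r s z - 1) / s) - ξ z * g z := by
      ext z; simp [hd, mul_sub]
    rw [e1, integral_sub hi1 hi2, slope_def_field, h0, hs.integral_eq hs1, sub_zero]
    have hir : Integrable (fun z => r s z * ξ z) (P : Measure Z) := by
      have := (hi1.const_mul s).add hξi
      refine this.congr (ae_of_all _ fun z => ?_)
      simp only [Pi.add_apply]
      field_simp
      ring
    rw [← integral_sub hir hξi, ← integral_div]
    congr 2
    ext z
    ring
  rw [e]
  have hd1 : ‖∫ z, ξ z * d z ∂(P : Measure Z)‖ₑ ≤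
      eLpNorm ξ 2 (P : Measure Z) * eLpNorm d 2 (P : Measure Z) := by
    refine (enorm_integral_le_lintegral_enorm _).trans ?_
    have := eLpNorm_smul_le_mul_eLpNorm (p := 2) (q := 2) (r := 1) hdL.1 hξ.1
    rwa [eLpNorm_one_eq_lintegral_enorm] at this
  rw [← toReal_enorm]
  exact ENNReal.toReal_mono (ENNReal.mul_ne_top hξ.eLpNorm_ne_top hdL.eLpNorm_ne_top) hd1

end EIF

variable {𝒳 : Type*} [MeasurableSpace 𝒳]

/-! ### Laws of the covariates and the treatment -/

/-- The measure `da₀ dP(x)`. -/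
abbrev baseMeasure (P : ProbabilityMeasure (Obs 𝒳)) : Measure (𝒳 × ℝ) :=
  (covLaw P).prod volume

theorem measurable_covTreat : Measurable (covTreat : Obs 𝒳 → 𝒳 × ℝ) := by
  unfold covTreat; fun_prop

theorem measurable_outcome : Measurable (outcome : Obs 𝒳 → ℝ) := by
  unfold outcome; fun_prop

instance (P : ProbabilityMeasure (Obs 𝒳)) : IsProbabilityMeasure (covLaw P) :=
  Measure.isProbabilityMeasure_map measurable_fst.aemeasurable

instance (P : ProbabilityMeasure (Obs 𝒳)) : IsProbabilityMeasure (covTreatLaw P) :=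
  Measure.isProbabilityMeasure_map measurable_covTreat.aemeasurable

theorem integrable_of_abs_le {α : Type*} [MeasurableSpace α] {μ : Measure α} {f g : α → ℝ}
    (hg : Integrable g μ) (hf : Measurable f) (h : ∀ᵐ x ∂μ, |f x| ≤ g x) : Integrable f μ :=
  hg.mono' hf.aestronglyMeasurable h

/-- `π` is a density of the law of `(X, A)` with respect to `da₀ dP(x)`. -/
structure IsTreatmentDensity (P : ProbabilityMeasure (Obs 𝒳)) (π : 𝒳 → ℝ → ℝ) : Prop where
  measurable : Measurable (fun w : 𝒳 × ℝ => π w.1 w.2)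
  nonneg : ∀ x a, 0 ≤ π x a
  law : covTreatLaw P = (baseMeasure P).withDensity (fun w => ENNReal.ofReal (π w.1 w.2))

theorem IsPropensityScore.isTreatmentDensity {P : ProbabilityMeasure (Obs 𝒳)} {π : 𝒳 → ℝ → ℝ}
    (h : IsPropensityScore P π) : IsTreatmentDensity P π :=
  ⟨h.measurable, h.nonneg, h.law⟩

/-- This version is a Radon–Nikodym derivative and need not integrate to one for every single `x`,
which is why `IsTreatmentDensity` omits that clause of `IsPropensityScore`. -/
theorem isTreatmentDensity_propScore {P : ProbabilityMeasure (Obs 𝒳)}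
    (h : covTreatLaw P ≪ baseMeasure P) : IsTreatmentDensity P (propScore P) where
  measurable := (Measure.measurable_rnDeriv _ _).ennreal_toReal
  nonneg _ _ := ENNReal.toReal_nonneg
  law := by
    conv_lhs => rw [← Measure.withDensity_rnDeriv_eq _ _ h]
    refine withDensity_congr_ae ?_
    filter_upwards [Measure.rnDeriv_lt_top (covTreatLaw P) (baseMeasure P)] with w hw
    simp [propScore, ENNReal.ofReal_toReal hw.ne]

namespace IsTreatmentDensity

variable {P : ProbabilityMeasure (Obs 𝒳)} {π : 𝒳 → ℝ → ℝ}

theorem propScore_ae_eq (h : IsTreatmentDensity P π) :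
    ∀ᵐ w ∂(baseMeasure P), propScore P w.1 w.2 = π w.1 w.2 := by
  have := Measure.rnDeriv_withDensity (baseMeasure P) h.measurable.ennreal_ofReal
  rw [← h.law] at this
  filter_upwards [this] with w hw
  simp [propScore, hw, h.nonneg]

theorem integrable_covTreatLaw_iff (h : IsTreatmentDensity P π) {F : 𝒳 × ℝ → ℝ} :
    Integrable F (covTreatLaw P) ↔ Integrable (fun w => π w.1 w.2 * F w) (baseMeasure P) := by
  rw [h.law, integrable_withDensity_iff_integrable_smul' h.measurable.ennreal_ofReal (by simp)]
  simp [ENNReal.toReal_ofReal (h.nonneg _ _)]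

theorem integrable_iff (h : IsTreatmentDensity P π) {F : 𝒳 × ℝ → ℝ} (hF : Measurable F) :
    Integrable (fun z : Obs 𝒳 => F (z.1, z.2.1)) (P : Measure (Obs 𝒳)) ↔
      Integrable (fun w => π w.1 w.2 * F w) (baseMeasure P) := by
  rw [← h.integrable_covTreatLaw_iff]
  exact (integrable_map_measure hF.aestronglyMeasurable measurable_covTreat.aemeasurable).symm

theorem integral_eq (h : IsTreatmentDensity P π) {F : 𝒳 × ℝ → ℝ} (hF : Measurable F) :
    ∫ z, F (z.1, z.2.1) ∂(P : Measure (Obs 𝒳)) =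
      ∫ w, π w.1 w.2 * F w ∂(baseMeasure P) := by
  have : ∫ z, F (z.1, z.2.1) ∂(P : Measure (Obs 𝒳)) = ∫ w, F w ∂(covTreatLaw P) :=
    (integral_map measurable_covTreat.aemeasurable hF.aestronglyMeasurable).symm
  rw [this, h.law,
    integral_withDensity_eq_integral_toReal_smul h.measurable.ennreal_ofReal (by simp)]
  simp [ENNReal.toReal_ofReal (h.nonneg _ _)]

theorem integrable (h : IsTreatmentDensity P π) :
    Integrable (fun w : 𝒳 × ℝ => π w.1 w.2) (baseMeasure P) := by
  have := (h.integrable_covTreatLaw_iff (F := fun _ => 1)).1 (integrable_const _)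
  simpa using this

end IsTreatmentDensity

theorem integrable_fst_iff {P : ProbabilityMeasure (Obs 𝒳)} {f : 𝒳 → ℝ}
    (hf : AEStronglyMeasurable f (covLaw P)) :
    Integrable (fun z : Obs 𝒳 => f z.1) (P : Measure (Obs 𝒳)) ↔ Integrable f (covLaw P) :=
  (integrable_map_measure hf measurable_fst.aemeasurable).symm

theorem integral_fst {P : ProbabilityMeasure (Obs 𝒳)} {f : 𝒳 → ℝ}
    (hf : AEStronglyMeasurable f (covLaw P)) :
    ∫ z, f z.1 ∂(P : Measure (Obs 𝒳)) = ∫ x, f x ∂(covLaw P) :=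
  (integral_map measurable_fst.aemeasurable hf).symm

/-! ### Outcome regressions -/

namespace IsOutcomeRegression

variable {P : ProbabilityMeasure (Obs 𝒳)} {μ : 𝒳 → ℝ → ℝ}

/-- The weight is a function of `(X, A)` and can be pulled out of the conditional expectation. Only
`F Y` has to be integrable; integrability of `F μ`, and its square integrability in `memLp_mul`, are
conclusions. -/
theorem mul_condExp (h : IsOutcomeRegression P μ) {F : 𝒳 × ℝ → ℝ} (hF : Measurable F)
    (hi : Integrable (fun z : Obs 𝒳 => F (z.1, z.2.1) * z.2.2) (P : Measure (Obs 𝒳))) :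
    (fun z : Obs 𝒳 => F (z.1, z.2.1) * μ z.1 z.2.1) =ᵐ[(P : Measure (Obs 𝒳))]
      (P : Measure (Obs 𝒳))[fun z : Obs 𝒳 => F (z.1, z.2.1) * z.2.2 |
        MeasurableSpace.comap covTreat inferInstance] := by
  have hF' : StronglyMeasurable[MeasurableSpace.comap covTreat inferInstance]
      (fun z : Obs 𝒳 => F (z.1, z.2.1)) :=
    (hF.comp (comap_measurable covTreat)).stronglyMeasurable
  have := condExp_mul_of_stronglyMeasurable_left (g := outcome) hF' hi h.integrable
  filter_upwards [h.condExp, this] with z h1 h2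
  rw [h1]
  exact h2.symm

theorem integrable_mul (h : IsOutcomeRegression P μ) {F : 𝒳 × ℝ → ℝ} (hF : Measurable F)
    (hi : Integrable (fun z : Obs 𝒳 => F (z.1, z.2.1) * z.2.2) (P : Measure (Obs 𝒳))) :
    Integrable (fun z : Obs 𝒳 => F (z.1, z.2.1) * μ z.1 z.2.1) (P : Measure (Obs 𝒳)) :=
  integrable_condExp.congr (h.mul_condExp hF hi).symm

theorem memLp_mul (h : IsOutcomeRegression P μ) {F : 𝒳 × ℝ → ℝ} (hF : Measurable F)
    (hi : MemLp (fun z : Obs 𝒳 => F (z.1, z.2.1) * z.2.2) 2 (P : Measure (Obs 𝒳))) :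
    MemLp (fun z : Obs 𝒳 => F (z.1, z.2.1) * μ z.1 z.2.1) 2 (P : Measure (Obs 𝒳)) :=
  (memLp_congr_ae (h.mul_condExp hF (hi.integrable (by norm_num)))).2
    (hi.condExp (by norm_num))

theorem integral_mul (h : IsOutcomeRegression P μ) {F : 𝒳 × ℝ → ℝ} (hF : Measurable F)
    (hi : Integrable (fun z : Obs 𝒳 => F (z.1, z.2.1) * z.2.2) (P : Measure (Obs 𝒳))) :
    ∫ z, F (z.1, z.2.1) * μ z.1 z.2.1 ∂(P : Measure (Obs 𝒳)) =
      ∫ z, F (z.1, z.2.1) * z.2.2 ∂(P : Measure (Obs 𝒳)) := by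
  rw [integral_congr_ae (h.mul_condExp hF hi), integral_condExp measurable_covTreat.comap_le]

end IsOutcomeRegression

theorem isOutcomeRegression_outReg {P : ProbabilityMeasure (Obs 𝒳)}
    (h : Integrable outcome (P : Measure (Obs 𝒳))) : IsOutcomeRegression P (outReg P) where
  measurable := (stronglyMeasurable_id.integral_kernel
    (κ := condDistrib outcome covTreat (P : Measure (Obs 𝒳)))).measurable
  integrable := h
  condExp := (condExp_ae_eq_integral_condDistrib' measurable_covTreat h).symm

theorem IsOutcomeRegression.ae_eq {P : ProbabilityMeasure (Obs 𝒳)} {μ μ' : 𝒳 → ℝ → ℝ}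
    (h : IsOutcomeRegression P μ) (h' : IsOutcomeRegression P μ') :
    ∀ᵐ w ∂(covTreatLaw P), μ w.1 w.2 = μ' w.1 w.2 := by
  rw [covTreatLaw, ae_map_iff measurable_covTreat.aemeasurable
    (measurableSet_eq_fun h.measurable h'.measurable)]
  exact h.condExp.trans h'.condExp.symm

/-- Outcome regressions are determined only up to null sets of the law of `(X, A)`. Over `da₀ dP(x)`
this says something only where `π > 0`, and this is where positivity enters the identification of
the numerator. -/
theorem IsTreatmentDensity.ae_of_ae_covTreatLaw {P : ProbabilityMeasure (Obs 𝒳)}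
    {π : 𝒳 → ℝ → ℝ} (h : IsTreatmentDensity P π) {p : 𝒳 × ℝ → Prop}
    (hp : ∀ᵐ w ∂(covTreatLaw P), p w) : ∀ᵐ w ∂(baseMeasure P), 0 < π w.1 w.2 → p w := by
  rw [h.law, ae_withDensity_iff h.measurable.ennreal_ofReal] at hp
  filter_upwards [hp] with w hw h0
  exact hw (by simpa using h0)

/-! ### Kernels -/

section Kernel

variable {K : ℝ → ℝ} {h a : ℝ}

theorem IsKernel.measurable_scaledKernel (hK : IsKernel K) :
    Measurable (fun w : 𝒳 × ℝ => scaledKernel K h (w.2 - a)) := by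
  have := hK.measurable
  unfold scaledKernel
  fun_prop

theorem IsKernel.exists_abs_scaledKernel_le (hK : IsKernel K) :
    ∃ B, 0 ≤ B ∧ ∀ u, |scaledKernel K h u| ≤ B := by
  obtain ⟨B, hB⟩ := hK.bounded
  refine ⟨B / |h|, div_nonneg ((abs_nonneg _).trans (hB 0)) (abs_nonneg _), fun u => ?_⟩
  rw [scaledKernel, abs_div]
  exact div_le_div_of_nonneg_right (hB _) (abs_nonneg _)

theorem IsKernel.integrable_scaledKernel (hK : IsKernel K) (hh : 0 < h) :
    Integrable (fun a₀ => scaledKernel K h (a₀ - a)) :=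
  ((hK.integrable.comp_div hh.ne').div_const h).comp_sub_right a

theorem IsKernel.integrable_scaledKernel_prod (hK : IsKernel K) (hh : 0 < h)
    (P : ProbabilityMeasure (Obs 𝒳)) :
    Integrable (fun w : 𝒳 × ℝ => scaledKernel K h (w.2 - a)) (baseMeasure P) :=
  (hK.integrable_scaledKernel hh).comp_snd _

theorem ae_kernelMeasure_iff (hK : IsKernel K) {P : ProbabilityMeasure (Obs 𝒳)}
    {p : 𝒳 × ℝ → Prop} : (∀ᵐ w ∂(kernelMeasure K h a P), p w) ↔
      ∀ᵐ w ∂(baseMeasure P), scaledKernel K h (w.2 - a) ≠ 0 → p w := by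
  rw [kernelMeasure, ae_withDensity_iff hK.measurable_scaledKernel.abs.ennreal_ofReal]
  simp

theorem integrable_kernelMeasure_iff (hK : IsKernel K) {P : ProbabilityMeasure (Obs 𝒳)}
    {F : 𝒳 × ℝ → ℝ} (hF : Measurable F) : Integrable F (kernelMeasure K h a P) ↔
      Integrable (fun w => scaledKernel K h (w.2 - a) * F w) (baseMeasure P) := by
  have hm : Measurable (fun w : 𝒳 × ℝ => scaledKernel K h (w.2 - a)) :=
    hK.measurable_scaledKernel
  rw [kernelMeasure, integrable_withDensity_iff_integrable_smul' hm.abs.ennreal_ofReal (by simp)]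
  refine integrable_congr' ?_ ?_ ?_
  · exact (hm.abs.ennreal_ofReal.ennreal_toReal.fun_mul hF).aestronglyMeasurable
  · exact (hm.fun_mul hF).aestronglyMeasurable
  · exact ae_of_all _ fun w => by simp

end Kernel

/-! ### The von Mises expansions -/

section Expansion

variable {K : ℝ → ℝ} {h a : ℝ} {S : ℝ → ℝ → ℝ} {t L : ℝ}

omit [MeasurableSpace 𝒳] in
theorem phiNum_apply (π μ : 𝒳 → ℝ → ℝ) (z : Obs 𝒳) :
    phiNum K h a S t π μ z =
      scaledKernel K h (z.2.1 - a) * ((z.2.2 - μ z.1 z.2.1) * S (π z.1 z.2.1) t / π z.1 z.2.1)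
      + (∫ a₀, scaledKernel K h (a₀ - a) * S (π z.1 a₀) t * μ z.1 a₀)
      + scaledKernel K h (z.2.1 - a) * μ z.1 z.2.1 * dS S t (π z.1 z.2.1)
      - ∫ a₀, scaledKernel K h (a₀ - a) * μ z.1 a₀ * dS S t (π z.1 a₀) * π z.1 a₀ := rfl

omit [MeasurableSpace 𝒳] in
theorem phiDen_apply (π : 𝒳 → ℝ → ℝ) (z : Obs 𝒳) :
    phiDen K h a S t π z =
      (∫ a₀, scaledKernel K h (a₀ - a) * S (π z.1 a₀) t)
      + scaledKernel K h (z.2.1 - a) * dS S t (π z.1 z.2.1)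
      - ∫ a₀, scaledKernel K h (a₀ - a) * dS S t (π z.1 a₀) * π z.1 a₀ := rfl

/-- `S` is Lipschitz, so `|S(π)| ≤ |S(π')| + L |π'| + L |π|`. This moves integrability from one
propensity score to another, or from the zero function. -/
theorem integrable_mul_smoothing {P : ProbabilityMeasure (Obs 𝒳)} {f : 𝒳 × ℝ → ℝ}
    {π : 𝒳 → ℝ → ℝ} (hS : ContDiff ℝ 2 (fun p => S p t)) (hL : ∀ p, |dS S t p| ≤ L)
    (hf : Measurable f) (hπ : Measurable (fun w : 𝒳 × ℝ => π w.1 w.2)) {π' : 𝒳 → ℝ → ℝ}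
    (hfS : Integrable (fun w => f w * S (π' w.1 w.2) t) (baseMeasure P))
    (h' : Integrable (fun w => f w * π' w.1 w.2) (baseMeasure P))
    (hi : Integrable (fun w => f w * π w.1 w.2) (baseMeasure P)) :
    Integrable (fun w => f w * S (π w.1 w.2) t) (baseMeasure P) := by
  have hSm : Measurable (fun p => S p t) := hS.continuous.measurable
  have hL0 : 0 ≤ L := (abs_nonneg _).trans (hL 0)
  refine integrable_of_abs_le ((hfS.abs.fun_add (h'.abs.const_mul L)).fun_add (hi.abs.const_mul L))
    (hf.fun_mul (hSm.comp hπ)) (ae_of_all _ fun w => ?_)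
  simp only [abs_mul]
  have h1 := abs_sub_le_of_abs_dS_le hS hL (π w.1 w.2) (π' w.1 w.2)
  have h2 := abs_sub (π w.1 w.2) (π' w.1 w.2)
  have h3 := abs_sub_abs_le_abs_sub (S (π w.1 w.2) t) (S (π' w.1 w.2) t)
  have h4 : |S (π w.1 w.2) t| ≤ |S (π' w.1 w.2) t| + L * |π' w.1 w.2| + L * |π w.1 w.2| := by
    nlinarith
  have := mul_le_mul_of_nonneg_left h4 (abs_nonneg (f w))
  linarith

theorem integrable_mul_dS {α : Type*} [MeasurableSpace α] {μ : Measure α}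
    (hS : ContDiff ℝ 2 (fun p => S p t)) (hL : ∀ p, |dS S t p| ≤ L) {f p : α → ℝ}
    (hf : Integrable f μ) (hp : Measurable p) : Integrable (fun w => f w * dS S t (p w)) μ :=
  hf.mul_bdd (c := L) ((continuous_dS hS).measurable.comp hp).aestronglyMeasurable
    (ae_of_all _ fun w => hL (p w))

/-- The mean under `P` of the uncentered influence function of the numerator, with nuisance
functions `π'` and `μ'`, is `ψ(P)` up to the remainder. -/
theorem integrable_phiNum_and_integral (hK : IsKernel K) (hS : ContDiff ℝ 2 (fun p => S p t))
    (hL : ∀ p, |dS S t p| ≤ L) {P : ProbabilityMeasure (Obs 𝒳)} {π μ π' μ' : 𝒳 → ℝ → ℝ}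
    (hπ : IsTreatmentDensity P π) (hμ : IsOutcomeRegression P μ)
    (hpos : ∀ᵐ w ∂(kernelMeasure K h a P), 0 < π w.1 w.2)
    (hπ' : Measurable (fun w : 𝒳 × ℝ => π' w.1 w.2))
    (hμ' : Measurable (fun w : 𝒳 × ℝ => μ' w.1 w.2))
    (hc : CrossIntegrable K h a S t P μ π' μ')
    (hS1 : Integrable (fun w : 𝒳 × ℝ =>
      scaledKernel K h (w.2 - a) * μ w.1 w.2 * S (π w.1 w.2) t) (baseMeasure P)) :
    Integrable (phiNum K h a S t π' μ') (P : Measure (Obs 𝒳)) ∧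
      ∫ z, phiNum K h a S t π' μ' z ∂(P : Measure (Obs 𝒳)) =
        psiNum K h a S t P + remNum K h a S t P π μ π' μ' ∧
      Integrable (fun w : 𝒳 × ℝ => scaledKernel K h (w.2 - a) *
        (S (π' w.1 w.2) t / π' w.1 w.2 - dS S t (π' w.1 w.2)) *
          (π w.1 w.2 - π' w.1 w.2) * (μ w.1 w.2 - μ' w.1 w.2)) (baseMeasure P) ∧
      Integrable (fun w : 𝒳 × ℝ => scaledKernel K h (w.2 - a) * μ w.1 w.2 *
        taylorR2 S t (π' w.1 w.2) (π w.1 w.2)) (baseMeasure P) := by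
  have mS : Measurable (fun p => S p t) := hS.continuous.measurable
  have mD : Measurable (dS S t) := (continuous_dS hS).measurable
  have mk : Measurable (fun w : 𝒳 × ℝ => scaledKernel K h (w.2 - a)) := hK.measurable_scaledKernel
  have mp := hπ.measurable
  have mm := hμ.measurable
  have mS' : Measurable (fun w : 𝒳 × ℝ => S (π' w.1 w.2) t) := mS.comp hπ'
  have mD' : Measurable (fun w : 𝒳 × ℝ => dS S t (π' w.1 w.2)) := mD.comp hπ'
  obtain ⟨B, -, hB⟩ := hK.exists_abs_scaledKernel_le (h := h)
  -- integrals over the law of the observation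
  have w1 : Integrable (fun z : Obs 𝒳 => scaledKernel K h (z.2.1 - a) * S (π' z.1 z.2.1) t /
      π' z.1 z.2.1 * z.2.2) (P : Measure (Obs 𝒳)) :=
    hc.weighted_outcome.congr (ae_of_all _ fun z => by ring)
  have mF1 : Measurable (fun w : 𝒳 × ℝ => scaledKernel K h (w.2 - a) * S (π' w.1 w.2) t /
      π' w.1 w.2) := (mk.fun_mul mS').fun_div hπ'
  have i1 : Integrable (fun w : 𝒳 × ℝ => π w.1 w.2 * (scaledKernel K h (w.2 - a) *
      S (π' w.1 w.2) t / π' w.1 w.2 * μ w.1 w.2)) (baseMeasure P) :=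
    (hπ.integrable_iff (mF1.fun_mul mm)).1 (hμ.integrable_mul mF1 w1)
  have e1 : ∫ w : 𝒳 × ℝ, π w.1 w.2 * (scaledKernel K h (w.2 - a) *
      S (π' w.1 w.2) t / π' w.1 w.2 * μ w.1 w.2) ∂(baseMeasure P) =
      ∫ z : Obs 𝒳, scaledKernel K h (z.2.1 - a) * S (π' z.1 z.2.1) t / π' z.1 z.2.1 * z.2.2
        ∂(P : Measure (Obs 𝒳)) :=
    (hπ.integral_eq (mF1.fun_mul mm)).symm.trans (hμ.integral_mul mF1 w1)
  have mF2 : Measurable (fun w : 𝒳 × ℝ => scaledKernel K h (w.2 - a) * μ' w.1 w.2 *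
      S (π' w.1 w.2) t / π' w.1 w.2) := ((mk.fun_mul hμ').fun_mul mS').fun_div hπ'
  have i2 := (hπ.integrable_iff mF2).1 hc.weighted_regression
  have e2 := hπ.integral_eq mF2
  have i3 := (hπ.integrable_iff (mk.fun_mul hμ')).1 hc.regression
  have w3 : Integrable (fun z : Obs 𝒳 => scaledKernel K h (z.2.1 - a) * μ' z.1 z.2.1 *
      dS S t (π' z.1 z.2.1)) (P : Measure (Obs 𝒳)) :=
    integrable_mul_dS hS hL hc.regression (hπ'.comp measurable_covTreat)
  have e3 := hπ.integral_eq ((mk.fun_mul hμ').fun_mul mD')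
  have i7 : Integrable (fun w : 𝒳 × ℝ => π w.1 w.2 * (scaledKernel K h (w.2 - a) * μ w.1 w.2))
      (baseMeasure P) := (hπ.integrable_iff (mk.fun_mul mm)).1 <| hμ.integrable_mul mk <|
        hμ.integrable.bdd_mul (c := B) (mk.comp measurable_covTreat).aestronglyMeasurable
          (ae_of_all _ fun z => hB _)
  -- integrals over the base measure
  have i4 := (integrable_kernelMeasure_iff hK (mS'.fun_mul hμ')).1 hc.trimmed
  have i5 := (integrable_kernelMeasure_iff hK (hπ'.fun_mul hμ')).1 hc.product
  have i6 := (integrable_kernelMeasure_iff hK (hπ'.fun_mul mm)).1 hc.cross_product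
  have i9 : Integrable (fun w : 𝒳 × ℝ =>
      scaledKernel K h (w.2 - a) * μ w.1 w.2 * S (π' w.1 w.2) t) (baseMeasure P) :=
    integrable_mul_smoothing hS hL (mk.fun_mul mm) hπ' hS1
      (i7.congr (ae_of_all _ fun w => by ring)) (i6.congr (ae_of_all _ fun w => by ring))
  have i3' := integrable_mul_dS hS hL i3 hπ'
  have i5' := integrable_mul_dS hS hL i5 hπ'
  have i6' := integrable_mul_dS hS hL i6 hπ'
  have i7' := integrable_mul_dS hS hL i7 hπ'
  have hposb := (ae_kernelMeasure_iff hK).1 hpos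
  have hposb' := (ae_kernelMeasure_iff hK).1 hc.positivity
  -- The product is expanded into eight terms, each integrable by itself. Positivity of `π'` is
  -- needed to cancel `π'` in `S(π') / π' * π'`.
  have iA : Integrable (fun w : 𝒳 × ℝ => scaledKernel K h (w.2 - a) *
        (S (π' w.1 w.2) t / π' w.1 w.2 - dS S t (π' w.1 w.2)) *
          (π w.1 w.2 - π' w.1 w.2) * (μ w.1 w.2 - μ' w.1 w.2)) (baseMeasure P) := by
    refine ((((i1.sub' i2).sub' i9).fun_add i4).sub' i7' |>.fun_add i3' |>.fun_add i6' |>.sub' i5').congr ?_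
    filter_upwards [hposb'] with w hw
    by_cases h0 : scaledKernel K h (w.2 - a) = 0
    · simp [h0]
    · have := (hw h0).ne'
      field_simp
      ring
  have iB : Integrable (fun w : 𝒳 × ℝ => scaledKernel K h (w.2 - a) * μ w.1 w.2 *
        taylorR2 S t (π' w.1 w.2) (π w.1 w.2)) (baseMeasure P) := by
    refine ((hS1.sub' i9).sub' i7' |>.fun_add i6').congr (ae_of_all _ fun w => ?_)
    simp only [taylorR2]
    ring
  -- the functions of the covariates
  have j4 : Integrable (fun w : 𝒳 × ℝ => scaledKernel K h (w.2 - a) * S (π' w.1 w.2) t *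
      μ' w.1 w.2) (baseMeasure P) := i4.congr (ae_of_all _ fun w => by ring)
  have j5 : Integrable (fun w : 𝒳 × ℝ => scaledKernel K h (w.2 - a) * μ' w.1 w.2 *
      dS S t (π' w.1 w.2) * π' w.1 w.2) (baseMeasure P) :=
    i5'.congr (ae_of_all _ fun w => by ring)
  have f4 := j4.integral_prod_left
  have f5 := j5.integral_prod_left
  have w4 := (integrable_fst_iff f4.1).2 f4
  have w5 := (integrable_fst_iff f5.1).2 f5
  have e4 := integral_fst f4.1
  have e5 := integral_fst f5.1
  rw [← integral_prod _ j4] at e4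
  rw [← integral_prod _ j5] at e5
  have hphi : phiNum K h a S t π' μ' = fun z : Obs 𝒳 =>
      scaledKernel K h (z.2.1 - a) * S (π' z.1 z.2.1) t / π' z.1 z.2.1 * z.2.2
      - scaledKernel K h (z.2.1 - a) * μ' z.1 z.2.1 * S (π' z.1 z.2.1) t / π' z.1 z.2.1
      + (∫ a₀, scaledKernel K h (a₀ - a) * S (π' z.1 a₀) t * μ' z.1 a₀)
      + scaledKernel K h (z.2.1 - a) * μ' z.1 z.2.1 * dS S t (π' z.1 z.2.1)
      - ∫ a₀, scaledKernel K h (a₀ - a) * μ' z.1 a₀ * dS S t (π' z.1 a₀) * π' z.1 a₀ := by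
    ext z
    rw [phiNum_apply]
    ring
  -- The estimand uses fixed versions of the nuisances. The regressions agree where `π > 0`, hence
  -- wherever the kernel is nonzero.
  have hpsi : psiNum K h a S t P = ∫ w : 𝒳 × ℝ,
      scaledKernel K h (w.2 - a) * μ w.1 w.2 * S (π w.1 w.2) t ∂(baseMeasure P) := by
    have hae : (fun w : 𝒳 × ℝ => scaledKernel K h (w.2 - a) * S (propScore P w.1 w.2) t *
        outReg P w.1 w.2) =ᵐ[baseMeasure P]
        fun w => scaledKernel K h (w.2 - a) * μ w.1 w.2 * S (π w.1 w.2) t := by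
      filter_upwards [hposb, hπ.propScore_ae_eq, hπ.ae_of_ae_covTreatLaw
        ((isOutcomeRegression_outReg hμ.integrable).ae_eq hμ)] with w h1 h2 h3
      by_cases h0 : scaledKernel K h (w.2 - a) = 0
      · simp [h0]
      · rw [h2, h3 (h1 h0)]
        ring
    rw [← integral_congr_ae hae, integral_prod _ (hS1.congr hae.symm)]
    rfl
  refine ⟨?_, ?_, iA, iB⟩
  · rw [hphi]
    exact (((w1.sub' hc.weighted_regression).fun_add w4).fun_add w3).sub' w5
  -- In the difference of the two parts of the remainder the terms `S(π') μ`, `∂S(π') π μ` and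
  -- `∂S(π') π' μ` cancel. The rest is the integrand of the mean of `φ` minus that of `ψ(P)`.
  · have eR : remNum K h a S t P π μ π' μ' = ∫ w : 𝒳 × ℝ,
        (π w.1 w.2 * (scaledKernel K h (w.2 - a) * S (π' w.1 w.2) t / π' w.1 w.2 * μ w.1 w.2)
        - π w.1 w.2 * (scaledKernel K h (w.2 - a) * μ' w.1 w.2 * S (π' w.1 w.2) t / π' w.1 w.2)
        + scaledKernel K h (w.2 - a) * S (π' w.1 w.2) t * μ' w.1 w.2
        + π w.1 w.2 * (scaledKernel K h (w.2 - a) * μ' w.1 w.2) * dS S t (π' w.1 w.2)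
        - scaledKernel K h (w.2 - a) * μ' w.1 w.2 * dS S t (π' w.1 w.2) * π' w.1 w.2
        - scaledKernel K h (w.2 - a) * μ w.1 w.2 * S (π w.1 w.2) t) ∂(baseMeasure P) := by
      simp only [remNum, half_ddS_add_taylorR3]
      rw [← integral_prod (fun w : 𝒳 × ℝ => scaledKernel K h (w.2 - a) *
        (S (π' w.1 w.2) t / π' w.1 w.2 - dS S t (π' w.1 w.2)) *
          (π w.1 w.2 - π' w.1 w.2) * (μ w.1 w.2 - μ' w.1 w.2)) iA,
        ← integral_prod (fun w : 𝒳 × ℝ => scaledKernel K h (w.2 - a) * μ w.1 w.2 *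
        taylorR2 S t (π' w.1 w.2) (π w.1 w.2)) iB, ← integral_sub iA iB]
      refine integral_congr_ae ?_
      filter_upwards [hposb'] with w hw
      by_cases h0 : scaledKernel K h (w.2 - a) = 0
      · simp [h0]
      · have := (hw h0).ne'
        simp only [taylorR2]
        field_simp
        ring
    rw [integral_sub ((((i1.sub' i2).fun_add j4).fun_add i3').sub' j5) hS1,
      integral_sub (((i1.sub' i2).fun_add j4).fun_add i3') j5,
      integral_add ((i1.sub' i2).fun_add j4) i3', integral_add (i1.sub' i2) j4,
      integral_sub i1 i2] at eR
    rw [hphi, integral_sub (((w1.sub' hc.weighted_regression).fun_add w4).fun_add w3) w5,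
      integral_add ((w1.sub' hc.weighted_regression).fun_add w4) w3,
      integral_add (w1.sub' hc.weighted_regression) w4,
      integral_sub w1 hc.weighted_regression, e4, e5, e2, ← e1, eR, hpsi]
    have e3' : ∫ z, scaledKernel K h (z.2.1 - a) * μ' z.1 z.2.1 *
      dS S t (π' z.1 z.2.1) ∂(P : Measure (Obs 𝒳)) = ∫ w : 𝒳 × ℝ, π w.1 w.2 *
        (scaledKernel K h (w.2 - a) * μ' w.1 w.2) * dS S t (π' w.1 w.2) ∂(baseMeasure P) :=
      e3.trans (integral_congr_ae (ae_of_all _ fun w => by ring))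
    rw [e3']
    ring

/-- The mean under `P` of the uncentered influence function of the denominator, with nuisance
function `π'`, is `ψ(P)` up to the remainder. -/
theorem integrable_phiDen_and_integral (hK : IsKernel K) (hh : 0 < h)
    (hS : ContDiff ℝ 2 (fun p => S p t))
    (hL : ∀ p, |dS S t p| ≤ L) {P : ProbabilityMeasure (Obs 𝒳)} {π π' : 𝒳 → ℝ → ℝ}
    (hπ : IsTreatmentDensity P π) (hπ' : Measurable (fun w : 𝒳 × ℝ => π' w.1 w.2))
    (hi : Integrable (fun w : 𝒳 × ℝ => scaledKernel K h (w.2 - a) * π' w.1 w.2)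
      (baseMeasure P)) :
    Integrable (phiDen K h a S t π') (P : Measure (Obs 𝒳)) ∧
      ∫ z, phiDen K h a S t π' z ∂(P : Measure (Obs 𝒳)) =
        psiDen K h a S t P + remDen K h a S t P π π' ∧
      Integrable (fun w : 𝒳 × ℝ => scaledKernel K h (w.2 - a) *
        taylorR2 S t (π' w.1 w.2) (π w.1 w.2)) (baseMeasure P) := by
  have mk : Measurable (fun w : 𝒳 × ℝ => scaledKernel K h (w.2 - a)) := hK.measurable_scaledKernel
  have mD' : Measurable (fun w : 𝒳 × ℝ => dS S t (π' w.1 w.2)) :=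
    (continuous_dS hS).measurable.comp hπ'
  obtain ⟨B, -, hB⟩ := hK.exists_abs_scaledKernel_le (h := h)
  have ik := hK.integrable_scaledKernel_prod (a := a) hh P
  have ip : Integrable (fun w : 𝒳 × ℝ => scaledKernel K h (w.2 - a) * π w.1 w.2)
      (baseMeasure P) := hπ.integrable.bdd_mul (c := B) mk.aestronglyMeasurable (ae_of_all _ fun w => hB _)
  -- The zero function serves as the comparison propensity score: `S 0 t` is a constant and the
  -- kernel is integrable.
  have h0 : Integrable (fun w : 𝒳 × ℝ => scaledKernel K h (w.2 - a) * S ((fun _ _ => 0 : 𝒳 → ℝ → ℝ)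
      w.1 w.2) t) (baseMeasure P) := ik.mul_const _
  have h0' : Integrable (fun w : 𝒳 × ℝ => scaledKernel K h (w.2 - a) * (fun _ _ => 0 : 𝒳 → ℝ → ℝ)
      w.1 w.2) (baseMeasure P) := by simp
  have i1 := integrable_mul_smoothing hS hL (π' := fun _ _ => 0) mk hπ.measurable h0 h0' ip
  have j4 := integrable_mul_smoothing hS hL (π' := fun _ _ => 0) mk hπ' h0 h0' hi
  have j5 : Integrable (fun w : 𝒳 × ℝ => scaledKernel K h (w.2 - a) * dS S t (π' w.1 w.2) *
      π' w.1 w.2) (baseMeasure P) :=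
    (integrable_mul_dS hS hL hi hπ').congr (ae_of_all _ fun w => by ring)
  have i3 := integrable_mul_dS hS hL ip hπ'
  have w3 : Integrable (fun z : Obs 𝒳 => scaledKernel K h (z.2.1 - a) *
      dS S t (π' z.1 z.2.1)) (P : Measure (Obs 𝒳)) := (hπ.integrable_iff (mk.fun_mul mD')).2
        (i3.congr (ae_of_all _ fun w => by ring))
  have e3 : ∫ z, scaledKernel K h (z.2.1 - a) * dS S t (π' z.1 z.2.1) ∂(P : Measure (Obs 𝒳)) =
      ∫ w : 𝒳 × ℝ, scaledKernel K h (w.2 - a) * π w.1 w.2 * dS S t (π' w.1 w.2)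
        ∂(baseMeasure P) :=
    (hπ.integral_eq (mk.fun_mul mD')).trans (integral_congr_ae (ae_of_all _ fun w => by
      ring))
  have iB : Integrable (fun w : 𝒳 × ℝ => scaledKernel K h (w.2 - a) *
        taylorR2 S t (π' w.1 w.2) (π w.1 w.2)) (baseMeasure P) := by
    refine ((i1.sub' j4).sub' i3 |>.fun_add j5).congr (ae_of_all _ fun w => ?_)
    simp only [taylorR2]
    ring
  have f4 := j4.integral_prod_left
  have f5 := j5.integral_prod_left
  have w4 := (integrable_fst_iff f4.1).2 f4
  have w5 := (integrable_fst_iff f5.1).2 f5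
  have e4 := integral_fst f4.1
  have e5 := integral_fst f5.1
  rw [← integral_prod _ j4] at e4
  rw [← integral_prod _ j5] at e5
  have hphi : phiDen K h a S t π' = fun z : Obs 𝒳 =>
      (∫ a₀, scaledKernel K h (a₀ - a) * S (π' z.1 a₀) t)
      + scaledKernel K h (z.2.1 - a) * dS S t (π' z.1 z.2.1)
      - ∫ a₀, scaledKernel K h (a₀ - a) * dS S t (π' z.1 a₀) * π' z.1 a₀ := by
    ext z
    exact phiDen_apply _ _
  have hpsi : psiDen K h a S t P = ∫ w : 𝒳 × ℝ,
      scaledKernel K h (w.2 - a) * S (π w.1 w.2) t ∂(baseMeasure P) := by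
    have hae : (fun w : 𝒳 × ℝ => scaledKernel K h (w.2 - a) * S (propScore P w.1 w.2) t)
        =ᵐ[baseMeasure P] fun w => scaledKernel K h (w.2 - a) * S (π w.1 w.2) t := by
      filter_upwards [hπ.propScore_ae_eq] with w h2
      rw [h2]
    rw [← integral_congr_ae hae, integral_prod _ (i1.congr hae.symm)]
    rfl
  refine ⟨?_, ?_, iB⟩
  · rw [hphi]
    exact (w4.fun_add w3).sub' w5
  · have eR : remDen K h a S t P π π' = -∫ w : 𝒳 × ℝ,
        (scaledKernel K h (w.2 - a) * S (π w.1 w.2) t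
        - scaledKernel K h (w.2 - a) * S (π' w.1 w.2) t
        - scaledKernel K h (w.2 - a) * π w.1 w.2 * dS S t (π' w.1 w.2)
        + scaledKernel K h (w.2 - a) * dS S t (π' w.1 w.2) * π' w.1 w.2) ∂(baseMeasure P) := by
      simp only [remDen, half_ddS_add_taylorR3]
      rw [← integral_prod (fun w : 𝒳 × ℝ => scaledKernel K h (w.2 - a) *
        taylorR2 S t (π' w.1 w.2) (π w.1 w.2)) iB]
      congr 2
      ext w
      simp only [taylorR2]
      ring
    rw [integral_add ((i1.sub' j4).sub' i3) j5, integral_sub (i1.sub' j4) i3,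
      integral_sub i1 j4] at eR
    rw [hphi, integral_sub (w4.fun_add w3) w5, integral_add w4 w3, e4, e5, e3, eR, hpsi]
    ring

end Expansion

/-! ### Exactness at the true nuisances, and bounds for the remainders. -/

section Remainder

variable {K : ℝ → ℝ} {h a : ℝ} {S : ℝ → ℝ → ℝ} {t L : ℝ}

/-- Where the kernel lives, `K_h μ S` is `π` times `(K_h S / π) μ`, and the latter is the
conditional mean of the integrable inverse-weighted outcome. -/
theorem NumRegular.integrable_mul_smoothing (hK : IsKernel K)
    (hS : ContDiff ℝ 2 (fun p => S p t)) {P : ProbabilityMeasure (Obs 𝒳)} {π μ : 𝒳 → ℝ → ℝ}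
    (hr : NumRegular K h a S t P π) (hπ : IsTreatmentDensity P π)
    (hμ : IsOutcomeRegression P μ) :
    Integrable (fun w : 𝒳 × ℝ =>
      scaledKernel K h (w.2 - a) * μ w.1 w.2 * S (π w.1 w.2) t) (baseMeasure P) := by
  have mk : Measurable (fun w : 𝒳 × ℝ => scaledKernel K h (w.2 - a)) := hK.measurable_scaledKernel
  have mF : Measurable (fun w : 𝒳 × ℝ => scaledKernel K h (w.2 - a) * S (π w.1 w.2) t /
      π w.1 w.2) := (mk.mul (hS.continuous.measurable.comp hπ.measurable)).div hπ.measurable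
  have w1 : Integrable (fun z : Obs 𝒳 => scaledKernel K h (z.2.1 - a) * S (π z.1 z.2.1) t /
      π z.1 z.2.1 * z.2.2) (P : Measure (Obs 𝒳)) :=
    (hr.weighted_memLp.integrable (by norm_num)).congr (ae_of_all _ fun z => by ring)
  refine ((hπ.integrable_iff (mF.fun_mul hμ.measurable)).1 (hμ.integrable_mul mF w1)).congr ?_
  filter_upwards [(ae_kernelMeasure_iff hK).1 hr.positivity] with w hw
  by_cases h0 : scaledKernel K h (w.2 - a) = 0
  · simp [h0]
  · have := (hw h0).ne'
    field_simp

theorem NumRegular.crossIntegrable_self (hK : IsKernel K)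
    (hS : ContDiff ℝ 2 (fun p => S p t)) {P : ProbabilityMeasure (Obs 𝒳)} {π μ : 𝒳 → ℝ → ℝ}
    (hr : NumRegular K h a S t P π) (hπ : IsTreatmentDensity P π)
    (hμ : IsOutcomeRegression P μ) : CrossIntegrable K h a S t P μ π μ := by
  have mk : Measurable (fun w : 𝒳 × ℝ => scaledKernel K h (w.2 - a)) := hK.measurable_scaledKernel
  have mS : Measurable (fun w : 𝒳 × ℝ => S (π w.1 w.2) t) :=
    hS.continuous.measurable.comp hπ.measurable
  have mF : Measurable (fun w : 𝒳 × ℝ => scaledKernel K h (w.2 - a) * S (π w.1 w.2) t /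
      π w.1 w.2) := (mk.mul mS).div hπ.measurable
  have wo := hr.weighted_memLp.integrable (by norm_num)
  have w1 : Integrable (fun z : Obs 𝒳 => scaledKernel K h (z.2.1 - a) * S (π z.1 z.2.1) t /
      π z.1 z.2.1 * z.2.2) (P : Measure (Obs 𝒳)) := wo.congr (ae_of_all _ fun z => by ring)
  obtain ⟨B, -, hB⟩ := hK.exists_abs_scaledKernel_le (h := h)
  have w2 : Integrable (fun z : Obs 𝒳 => scaledKernel K h (z.2.1 - a) * μ z.1 z.2.1)
      (P : Measure (Obs 𝒳)) := hμ.integrable_mul mk <| hμ.integrable.bdd_mul (c := B)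
        (mk.comp measurable_covTreat).aestronglyMeasurable (ae_of_all _ fun z => hB _)
  have i2 : Integrable (fun w : 𝒳 × ℝ => π w.1 w.2 * μ w.1 w.2) (kernelMeasure K h a P) :=
    (integrable_kernelMeasure_iff hK (hπ.measurable.fun_mul hμ.measurable)).2 <|
      ((hπ.integrable_iff (mk.fun_mul hμ.measurable)).1 w2).congr (ae_of_all _ fun w => by ring)
  exact
    { positivity := hr.positivity
      weighted_outcome := wo
      weighted_regression := (hμ.integrable_mul mF w1).congr (ae_of_all _ fun z => by ring)
      regression := w2
      trimmed := (integrable_kernelMeasure_iff hK (mS.fun_mul hμ.measurable)).2 <|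
        (hr.integrable_mul_smoothing hK hS hπ hμ).congr (ae_of_all _ fun w => by ring)
      product := i2
      cross_product := i2 }

/-- The mean identity with `π' = π` and `μ' = μ`, where every term of the remainder is zero. -/
theorem NumRegular.integral_phiNum (hK : IsKernel K) (hS : ContDiff ℝ 2 (fun p => S p t))
    (hL : ∀ p, |dS S t p| ≤ L) {P : ProbabilityMeasure (Obs 𝒳)} {π μ : 𝒳 → ℝ → ℝ}
    (hr : NumRegular K h a S t P π) (hπ : IsTreatmentDensity P π)
    (hμ : IsOutcomeRegression P μ) :
    ∫ z, phiNum K h a S t π μ z ∂(P : Measure (Obs 𝒳)) = psiNum K h a S t P := by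
  have h1 := (integrable_phiNum_and_integral hK hS hL hπ hμ hr.positivity hπ.measurable
    hμ.measurable (hr.crossIntegrable_self hK hS hπ hμ)
    (hr.integrable_mul_smoothing hK hS hπ hμ)).2.1
  rw [h1]
  simp [remNum, taylorR3]

theorem IsTreatmentDensity.integral_phiDen (hK : IsKernel K) (hh : 0 < h)
    (hS : ContDiff ℝ 2 (fun p => S p t)) (hL : ∀ p, |dS S t p| ≤ L)
    {P : ProbabilityMeasure (Obs 𝒳)} {π : 𝒳 → ℝ → ℝ} (hπ : IsTreatmentDensity P π) :
    ∫ z, phiDen K h a S t π z ∂(P : Measure (Obs 𝒳)) = psiDen K h a S t P := by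
  obtain ⟨B, -, hB⟩ := hK.exists_abs_scaledKernel_le (h := h)
  have h1 := (integrable_phiDen_and_integral (a := a) hK hh hS hL hπ hπ.measurable
    (hπ.integrable.bdd_mul (c := B) hK.measurable_scaledKernel.aestronglyMeasurable
      (ae_of_all _ fun w => hB _))).2.1
  rw [h1]
  simp [remDen, taylorR3]

/-- A propensity score is integrable over `da₀ dP(x)` for every law `P`. -/
theorem IsPropensityScore.integrable_prod {P P' : ProbabilityMeasure (Obs 𝒳)} {π : 𝒳 → ℝ → ℝ}
    (hπ : IsPropensityScore P' π) :
    Integrable (fun w : 𝒳 × ℝ => π w.1 w.2) (baseMeasure P) := by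
  refine ⟨hπ.measurable.aestronglyMeasurable, ?_⟩
  rw [hasFiniteIntegral_iff_ofReal (ae_of_all _ fun w => hπ.nonneg _ _),
    lintegral_prod _ hπ.measurable.ennreal_ofReal.aemeasurable]
  -- Normalization at every `x` is essential: the covariate law here is that of `P`, which may
  -- charge null sets of that of `P'`.
  simp [hπ.lintegral_eq_one]

theorem IsPropensityScore.integrable_kernel_mul (hK : IsKernel K)
    {P P' : ProbabilityMeasure (Obs 𝒳)} {π : 𝒳 → ℝ → ℝ} (hπ : IsPropensityScore P' π) :
    Integrable (fun w : 𝒳 × ℝ => scaledKernel K h (w.2 - a) * π w.1 w.2) (baseMeasure P) := by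
  obtain ⟨B, -, hB⟩ := hK.exists_abs_scaledKernel_le (h := h)
  exact hπ.integrable_prod.bdd_mul (c := B) hK.measurable_scaledKernel.aestronglyMeasurable
    (ae_of_all _ fun w => hB _)

theorem remNum_eq {P : ProbabilityMeasure (Obs 𝒳)} {π μ π' μ' : 𝒳 → ℝ → ℝ}
    (iA : Integrable (fun w : 𝒳 × ℝ => scaledKernel K h (w.2 - a) *
        (S (π' w.1 w.2) t / π' w.1 w.2 - dS S t (π' w.1 w.2)) *
          (π w.1 w.2 - π' w.1 w.2) * (μ w.1 w.2 - μ' w.1 w.2)) (baseMeasure P))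
    (iB : Integrable (fun w : 𝒳 × ℝ => scaledKernel K h (w.2 - a) * μ w.1 w.2 *
        taylorR2 S t (π' w.1 w.2) (π w.1 w.2)) (baseMeasure P)) :
    remNum K h a S t P π μ π' μ' =
      (∫ w : 𝒳 × ℝ, scaledKernel K h (w.2 - a) *
        (S (π' w.1 w.2) t / π' w.1 w.2 - dS S t (π' w.1 w.2)) *
          (π w.1 w.2 - π' w.1 w.2) * (μ w.1 w.2 - μ' w.1 w.2) ∂(baseMeasure P))
      - ∫ w : 𝒳 × ℝ, scaledKernel K h (w.2 - a) * μ w.1 w.2 *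
        taylorR2 S t (π' w.1 w.2) (π w.1 w.2) ∂(baseMeasure P) := by
  simp only [remNum, half_ddS_add_taylorR3]
  rw [integral_prod _ iA, integral_prod _ iB]

theorem remDen_eq {P : ProbabilityMeasure (Obs 𝒳)} {π π' : 𝒳 → ℝ → ℝ}
    (iB : Integrable (fun w : 𝒳 × ℝ => scaledKernel K h (w.2 - a) *
        taylorR2 S t (π' w.1 w.2) (π w.1 w.2)) (baseMeasure P)) :
    remDen K h a S t P π π' = -∫ w : 𝒳 × ℝ, scaledKernel K h (w.2 - a) *
        taylorR2 S t (π' w.1 w.2) (π w.1 w.2) ∂(baseMeasure P) := by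
  simp only [remDen, half_ddS_add_taylorR3]
  rw [integral_prod _ iB]

/-- The Cauchy–Schwarz inequality for the kernel-weighted norm. -/
theorem ofReal_abs_integral_le (hK : IsKernel K) {P : ProbabilityMeasure (Obs 𝒳)}
    {F f g : 𝒳 × ℝ → ℝ} {C : ℝ} (hf : Measurable f) (hg : Measurable g)
    (hF : ∀ᵐ w ∂(baseMeasure P), |F w| ≤ |scaledKernel K h (w.2 - a)| * (C * (|f w| * |g w|))) :
    ENNReal.ofReal |∫ w, F w ∂(baseMeasure P)| ≤ ENNReal.ofReal C *
      (eLpNorm f 2 (kernelMeasure K h a P) * eLpNorm g 2 (kernelMeasure K h a P)) := by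
  have mk : Measurable (fun w : 𝒳 × ℝ => scaledKernel K h (w.2 - a)) := hK.measurable_scaledKernel
  have hH := eLpNorm_smul_le_mul_eLpNorm (p := 2) (q := 2) (r := 1)
    (μ := kernelMeasure K h a P) hg.aestronglyMeasurable hf.aestronglyMeasurable
  rw [eLpNorm_one_eq_lintegral_enorm] at hH
  rw [← Real.enorm_eq_ofReal_abs]
  calc ‖∫ w, F w ∂(baseMeasure P)‖ₑ ≤ ∫⁻ w, ‖F w‖ₑ ∂(baseMeasure P) :=
        enorm_integral_le_lintegral_enorm _
    _ ≤ ∫⁻ w, ENNReal.ofReal |scaledKernel K h (w.2 - a)| *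
          (ENNReal.ofReal C * ‖f w * g w‖ₑ) ∂(baseMeasure P) := by
        refine lintegral_mono_ae ?_
        filter_upwards [hF] with w hw
        rw [Real.enorm_eq_ofReal_abs, Real.enorm_eq_ofReal_abs, abs_mul,
          ← ENNReal.ofReal_mul' (by positivity), ← ENNReal.ofReal_mul (abs_nonneg _)]
        exact ENNReal.ofReal_le_ofReal hw
    _ = ∫⁻ w, ENNReal.ofReal C * ‖f w * g w‖ₑ ∂(kernelMeasure K h a P) := by
        rw [kernelMeasure, lintegral_withDensity_eq_lintegral_mul _ mk.abs.ennreal_ofReal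
          (g := fun w => ENNReal.ofReal C * ‖f w * g w‖ₑ)
          (measurable_const.fun_mul (hf.fun_mul hg).enorm)]
        rfl
    _ = ENNReal.ofReal C * ∫⁻ w, ‖f w * g w‖ₑ ∂(kernelMeasure K h a P) :=
        lintegral_const_mul _ (hf.mul hg).enorm
    _ ≤ _ := by gcongr; exact hH

/-- Stating the bound in `ℝ≥0∞` lets it stand without assuming that the distance is finite. -/
theorem ofReal_abs_remDen_le (hK : IsKernel K) (hS : ContDiff ℝ 2 (fun p => S p t))
    {P : ProbabilityMeasure (Obs 𝒳)} {π π' : 𝒳 → ℝ → ℝ}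
    (hπ : Measurable (fun w : 𝒳 × ℝ => π w.1 w.2))
    (hπ' : Measurable (fun w : 𝒳 × ℝ => π' w.1 w.2))
    (iB : Integrable (fun w : 𝒳 × ℝ => scaledKernel K h (w.2 - a) *
        taylorR2 S t (π' w.1 w.2) (π w.1 w.2)) (baseMeasure P))
    {B : ℝ} (hB : ∀ p, |ddS S t p| ≤ B) :
    ENNReal.ofReal |remDen K h a S t P π π'| ≤
      ENNReal.ofReal (B / 2) * kernelDist K h a P π π' ^ 2 := by
  rw [remDen_eq iB, abs_neg, sq]
  refine ofReal_abs_integral_le hK (hπ.sub hπ') (hπ.sub hπ') (ae_of_all _ fun w => ?_)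
  rw [abs_mul, abs_mul_abs_self, ← sq]
  gcongr
  exact abs_taylorR2_le hS hB _ _

theorem ofReal_abs_remNum_le (hK : IsKernel K) (hS : ContDiff ℝ 2 (fun p => S p t))
    (hL : ∀ p, |dS S t p| ≤ L)
    {P : ProbabilityMeasure (Obs 𝒳)} {π μ π' μ' : 𝒳 → ℝ → ℝ}
    (hπ : Measurable (fun w : 𝒳 × ℝ => π w.1 w.2))
    (hμ : Measurable (fun w : 𝒳 × ℝ => μ w.1 w.2))
    (hπ' : Measurable (fun w : 𝒳 × ℝ => π' w.1 w.2))
    (hμ' : Measurable (fun w : 𝒳 × ℝ => μ' w.1 w.2))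
    (iA : Integrable (fun w : 𝒳 × ℝ => scaledKernel K h (w.2 - a) *
        (S (π' w.1 w.2) t / π' w.1 w.2 - dS S t (π' w.1 w.2)) *
          (π w.1 w.2 - π' w.1 w.2) * (μ w.1 w.2 - μ' w.1 w.2)) (baseMeasure P))
    (iB : Integrable (fun w : 𝒳 × ℝ => scaledKernel K h (w.2 - a) * μ w.1 w.2 *
        taylorR2 S t (π' w.1 w.2) (π w.1 w.2)) (baseMeasure P))
    {c B M : ℝ} (hc : 0 < c) (hcπ : ∀ᵐ w ∂(kernelMeasure K h a P), c ≤ π' w.1 w.2)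
    (hM : ∀ᵐ w ∂(kernelMeasure K h a P), |μ w.1 w.2| ≤ M) (hB : ∀ p, |ddS S t p| ≤ B) :
    ENNReal.ofReal |remNum K h a S t P π μ π' μ'| ≤
      ENNReal.ofReal (|S 0 t| / c + 2 * L) *
        (kernelDist K h a P π π' * kernelDist K h a P μ μ')
      + ENNReal.ofReal (B * M / 2) * kernelDist K h a P π π' ^ 2 := by
  rw [remNum_eq iA iB]
  refine (ENNReal.ofReal_le_ofReal (abs_sub _ _)).trans ?_
  rw [ENNReal.ofReal_add (abs_nonneg _) (abs_nonneg _), sq]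
  refine add_le_add (ofReal_abs_integral_le hK (hπ.sub hπ') (hμ.sub hμ') ?_)
    (ofReal_abs_integral_le hK (hπ.sub hπ') (hπ.sub hπ') ?_)
  · filter_upwards [(ae_kernelMeasure_iff hK).1 hcπ] with w hw
    by_cases h0 : scaledKernel K h (w.2 - a) = 0
    · simp [h0]
    · have hp := hw h0
      have hp0 : 0 < π' w.1 w.2 := hc.trans_le hp
      rw [abs_mul, abs_mul, abs_mul, mul_assoc, mul_assoc]
      gcongr
      -- Comparing `S(π')` with `S(0)` gives `|S(π') / π'| ≤ |S(0)| / c + L`; the derivative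
      -- contributes the second `L`.
      have h1 := abs_sub_le_of_abs_dS_le hS hL (π' w.1 w.2) 0
      rw [sub_zero, abs_of_pos hp0] at h1
      have h2 : |S (π' w.1 w.2) t| ≤ |S 0 t| + L * π' w.1 w.2 := by
        have := abs_sub_abs_le_abs_sub (S (π' w.1 w.2) t) (S 0 t)
        linarith
      have h3 : |S (π' w.1 w.2) t / π' w.1 w.2| ≤ |S 0 t| / c + L := by
        rw [abs_div, abs_of_pos hp0, div_le_iff₀ hp0]
        have : |S 0 t| ≤ |S 0 t| / c * π' w.1 w.2 := by
          rw [div_mul_eq_mul_div, le_div_iff₀ hc]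
          exact mul_le_mul_of_nonneg_left hp (abs_nonneg _)
        linarith
      have h4 := abs_sub (S (π' w.1 w.2) t / π' w.1 w.2) (dS S t (π' w.1 w.2))
      have := hL (π' w.1 w.2)
      linarith
  · filter_upwards [(ae_kernelMeasure_iff hK).1 hM] with w hw
    by_cases h0 : scaledKernel K h (w.2 - a) = 0
    · simp [h0]
    · rw [abs_mul, abs_mul, abs_mul_abs_self, ← sq, mul_assoc]
      refine mul_le_mul_of_nonneg_left ?_ (abs_nonneg _)
      have h1 := abs_taylorR2_le hS hB (π' w.1 w.2) (π w.1 w.2)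
      have h2 := hw h0
      calc _ ≤ M * (B / 2 * (π w.1 w.2 - π' w.1 w.2) ^ 2) :=
            mul_le_mul h2 h1 (abs_nonneg _) ((abs_nonneg _).trans h2)
        _ = _ := by ring

end Remainder

/-! ### Propensity score and outcome regression of a tilted law -/

namespace IsTilt

section General

variable {Z : Type*} [MeasurableSpace Z] {P Q : ProbabilityMeasure Z} {r : Z → ℝ} {ε : ℝ}

theorem integrable (hT : IsTilt P Q r ε) {f : Z → ℝ} (hf : Integrable f (P : Measure Z)) :
    Integrable f (Q : Measure Z) :=
  (hf.smul_measure ENNReal.ofReal_ne_top).mono_measure hT.le_smul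

end General

variable {P Q : ProbabilityMeasure (Obs 𝒳)} {r : Obs 𝒳 → ℝ} {ε : ℝ} {π μ : 𝒳 → ℝ → ℝ}

theorem covLaw_le (hT : IsTilt P Q r ε) : covLaw Q ≤ ENNReal.ofReal (1 + ε) • covLaw P := by
  rw [covLaw, covLaw, ← Measure.map_smul]
  exact Measure.map_mono hT.le_smul measurable_fst

theorem le_covLaw (hT : IsTilt P Q r ε) : ENNReal.ofReal (1 - ε) • covLaw P ≤ covLaw Q := by
  rw [covLaw, covLaw, ← Measure.map_smul]
  exact Measure.map_mono hT.smul_le measurable_fst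

theorem covTreatLaw_le (hT : IsTilt P Q r ε) :
    covTreatLaw Q ≤ ENNReal.ofReal (1 + ε) • covTreatLaw P := by
  rw [covTreatLaw, covTreatLaw, ← Measure.map_smul]
  exact Measure.map_mono hT.le_smul measurable_covTreat

theorem le_covTreatLaw (hT : IsTilt P Q r ε) :
    ENNReal.ofReal (1 - ε) • covTreatLaw P ≤ covTreatLaw Q := by
  rw [covTreatLaw, covTreatLaw, ← Measure.map_smul]
  exact Measure.map_mono hT.smul_le measurable_covTreat

theorem baseMeasure_le (hT : IsTilt P Q r ε) :
    baseMeasure Q ≤ ENNReal.ofReal (1 + ε) • baseMeasure P := by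
  rw [baseMeasure, baseMeasure, ← Measure.prod_smul_left]
  exact Measure.prod_mono hT.covLaw_le le_rfl

theorem le_baseMeasure (hT : IsTilt P Q r ε) :
    ENNReal.ofReal (1 - ε) • baseMeasure P ≤ baseMeasure Q := by
  rw [baseMeasure, baseMeasure, ← Measure.prod_smul_left]
  exact Measure.prod_mono hT.le_covLaw le_rfl

theorem integrable_baseMeasure (hT : IsTilt P Q r ε) {f : 𝒳 × ℝ → ℝ}
    (hf : Integrable f (baseMeasure P)) : Integrable f (baseMeasure Q) :=
  (hf.smul_measure ENNReal.ofReal_ne_top).mono_measure hT.baseMeasure_le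

theorem integral_le_two_mul (hT : IsTilt P Q r ε) (hε : ε ≤ 1 / 8) {f : 𝒳 × ℝ → ℝ}
    (hf : ∀ w, 0 ≤ f w) (hi : Integrable f (baseMeasure P)) :
    ∫ w, f w ∂(baseMeasure Q) ≤ 2 * ∫ w, f w ∂(baseMeasure P) := by
  have h1 := integral_mono_measure hT.baseMeasure_le (ae_of_all _ hf)
    (hi.smul_measure ENNReal.ofReal_ne_top)
  rw [integral_smul_measure, smul_eq_mul] at h1
  refine h1.trans (mul_le_mul_of_nonneg_right ?_ (integral_nonneg hf))
  exact ENNReal.toReal_le_of_le_ofReal (by norm_num) (ENNReal.ofReal_le_ofReal (by linarith))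

theorem baseMeasure_absolutelyContinuous (hT : IsTilt P Q r ε) :
    baseMeasure Q ≪ baseMeasure P :=
  Measure.absolutelyContinuous_of_le_smul hT.baseMeasure_le

/-- Absolute continuity is chained through `P`. The last link, from `da₀ dP(x)` to `da₀ dQ(x)`,
needs `1 - ε > 0`. -/
theorem isTreatmentDensity_propScore (hT : IsTilt P Q r ε) (hε : ε ≤ 1 / 8)
    (hπ : IsTreatmentDensity P π) : IsTreatmentDensity Q (propScore Q) := by
  refine TrimmedEffect.isTreatmentDensity_propScore ?_
  have h1 : covTreatLaw Q ≪ covTreatLaw P :=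
    Measure.absolutelyContinuous_of_le_smul hT.covTreatLaw_le
  have h2 : covTreatLaw P ≪ baseMeasure P := by
    rw [hπ.law]
    exact withDensity_absolutelyContinuous _ _
  have h3 : baseMeasure P ≪ baseMeasure Q := by
    have := (Measure.absolutelyContinuous_smul (μ := baseMeasure P)
      (c := ENNReal.ofReal (1 - ε)) (by simp; linarith))
    exact this.trans (Measure.absolutelyContinuous_of_le hT.le_baseMeasure)
  exact (h1.trans h2).trans h3

theorem ae_le_of_setLIntegral_le {α : Type*} [MeasurableSpace α] {ν : Measure α} [SigmaFinite ν]
    {f g : α → ℝ} (hf : Measurable f) (hg : Measurable g) (hg0 : ∀ x, 0 ≤ g x) {b c : ℝ}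
    (hb : 0 ≤ b) (hc : 0 ≤ c)
    (h : ∀ s, MeasurableSet s → ENNReal.ofReal b * ∫⁻ x in s, ENNReal.ofReal (f x) ∂ν ≤
      ENNReal.ofReal c * ∫⁻ x in s, ENNReal.ofReal (g x) ∂ν) :
    ∀ᵐ x ∂ν, b * f x ≤ c * g x := by
  have := ae_le_of_forall_setLIntegral_le_of_sigmaFinite (μ := ν)
    (f := fun x => ENNReal.ofReal b * ENNReal.ofReal (f x))
    (g := fun x => ENNReal.ofReal c * ENNReal.ofReal (g x))
    (measurable_const.mul hf.ennreal_ofReal) fun s hs _ => by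
      rw [lintegral_const_mul _ hf.ennreal_ofReal, lintegral_const_mul _ hg.ennreal_ofReal]
      exact h s hs
  filter_upwards [this] with x hx
  rw [← ENNReal.ofReal_mul hb, ← ENNReal.ofReal_mul hc] at hx
  exact (ENNReal.ofReal_le_ofReal_iff (mul_nonneg hc (hg0 x))).1 hx

/-- Comparing both the laws of `(X, A)` and the base measures on an arbitrary set gives `(1 - ε) π_Q
≤ (1 + ε) π` and the same with the two exchanged, almost everywhere. Hence `π_Q ≤ 2 π`, and the
difference is at most `ε (π + π_Q) ≤ 3 ε π`; the factor 4 leaves slack. -/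
theorem abs_propScore_sub_le (hT : IsTilt P Q r ε) (hε0 : 0 ≤ ε) (hε : ε ≤ 1 / 8)
    (hπ : IsTreatmentDensity P π) :
    ∀ᵐ w ∂(baseMeasure P), |propScore Q w.1 w.2 - π w.1 w.2| ≤ 4 * ε * π w.1 w.2 := by
  have hQ := hT.isTreatmentDensity_propScore hε hπ
  have e : ∀ {R : ProbabilityMeasure (Obs 𝒳)} {p : 𝒳 → ℝ → ℝ}, IsTreatmentDensity R p →
      ∀ s, MeasurableSet s → ∫⁻ w in s, ENNReal.ofReal (p w.1 w.2) ∂(baseMeasure R) =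
        covTreatLaw R s := fun hp s hs => by rw [hp.law, withDensity_apply _ hs]
  have mono : ∀ {ν₁ ν₂ : Measure (𝒳 × ℝ)} (c : ℝ) (f : 𝒳 × ℝ → ℝ≥0∞) (s : Set (𝒳 × ℝ)),
      ν₁ ≤ ENNReal.ofReal c • ν₂ → ∫⁻ w in s, f w ∂ν₁ ≤ ENNReal.ofReal c * ∫⁻ w in s, f w ∂ν₂ := by
    intro ν₁ ν₂ c f s hle
    refine (lintegral_mono' (Measure.restrict_mono le_rfl hle) le_rfl).trans_eq ?_
    rw [Measure.restrict_smul, lintegral_smul_measure, smul_eq_mul]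
  have mono' : ∀ {ν₁ ν₂ : Measure (𝒳 × ℝ)} (c : ℝ) (f : 𝒳 × ℝ → ℝ≥0∞) (s : Set (𝒳 × ℝ)),
      ENNReal.ofReal c • ν₁ ≤ ν₂ → ENNReal.ofReal c * ∫⁻ w in s, f w ∂ν₁ ≤ ∫⁻ w in s, f w ∂ν₂ := by
    intro ν₁ ν₂ c f s hle
    refine Eq.trans_le ?_ (lintegral_mono' (Measure.restrict_mono le_rfl hle) le_rfl)
    rw [Measure.restrict_smul, lintegral_smul_measure, smul_eq_mul]
  have h1 := ae_le_of_setLIntegral_le (ν := baseMeasure P) (b := 1 - ε) (c := 1 + ε)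
    hQ.measurable hπ.measurable (fun w => hπ.nonneg _ _) (by linarith) (by linarith) fun s hs => by
      refine (mono' _ _ s hT.le_baseMeasure).trans ?_
      rw [e hQ s hs, e hπ s hs]
      exact hT.covTreatLaw_le s
  have h2 := ae_le_of_setLIntegral_le (ν := baseMeasure P) (b := 1 - ε) (c := 1 + ε)
    hπ.measurable hQ.measurable (fun w => hQ.nonneg _ _) (by linarith) (by linarith) fun s hs => by
      rw [e hπ s hs]
      refine (hT.le_covTreatLaw s).trans ?_
      rw [← e hQ s hs]
      exact mono _ _ s hT.baseMeasure_le
  filter_upwards [h1, h2] with w h1 h2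
  have h3 := hπ.nonneg w.1 w.2
  have h4 := hQ.nonneg w.1 w.2
  have h5 : 0 ≤ ε * π w.1 w.2 := mul_nonneg hε0 h3
  have h6 : ε * propScore Q w.1 w.2 ≤ 1 / 8 * propScore Q w.1 w.2 :=
    mul_le_mul_of_nonneg_right hε h4
  have h7 : ε * (ε * π w.1 w.2) ≤ 1 / 8 * (ε * π w.1 w.2) := mul_le_mul_of_nonneg_right hε h5
  have h8 : 0 ≤ ε * (ε * π w.1 w.2) := mul_nonneg hε0 h5
  have h9 : propScore Q w.1 w.2 ≤ 2 * π w.1 w.2 := by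
    have : ε * π w.1 w.2 ≤ 1 / 8 * π w.1 w.2 := mul_le_mul_of_nonneg_right hε h3
    linarith
  have h10 : ε * propScore Q w.1 w.2 ≤ ε * (2 * π w.1 w.2) := mul_le_mul_of_nonneg_left h9 hε0
  rw [abs_le]
  constructor <;> linarith

/-- The outcome regression of a tilted law is close to the original one, in every weighted mean. -/
theorem integral_abs_outReg_sub_le (hT : IsTilt P Q r ε) (hε : ε ≤ 1)
    {μ' : 𝒳 → ℝ → ℝ} (hμ : IsOutcomeRegression P μ) (hμ' : IsOutcomeRegression Q μ')
    {F : 𝒳 × ℝ → ℝ} (hF : Measurable F) (hF0 : ∀ w, 0 ≤ F w)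
    (hi : Integrable (fun z : Obs 𝒳 => F (z.1, z.2.1) * z.2.2) (P : Measure (Obs 𝒳))) :
    Integrable (fun z : Obs 𝒳 => F (z.1, z.2.1) * |μ' z.1 z.2.1 - μ z.1 z.2.1|)
      (Q : Measure (Obs 𝒳)) ∧
    ∫ z, F (z.1, z.2.1) * |μ' z.1 z.2.1 - μ z.1 z.2.1| ∂(Q : Measure (Obs 𝒳)) ≤
      ε * ∫ z, F (z.1, z.2.1) * |z.2.2 - μ z.1 z.2.1| ∂(P : Measure (Obs 𝒳)) := by
  classical
  -- The sign of `μ' - μ` is a function of `(X, A)`, so it can be absorbed into the weight. The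
  -- integrand becomes linear in `μ'`, which may then be replaced by `Y` under `Q`.
  set σ : 𝒳 × ℝ → ℝ := fun w => if μ w.1 w.2 ≤ μ' w.1 w.2 then 1 else -1 with hσ
  have mσ : Measurable σ := Measurable.ite (measurableSet_le hμ.measurable hμ'.measurable)
    measurable_const measurable_const
  have bσ : ∀ w, |σ w| ≤ 1 := fun w => by
    simp only [hσ]; split_ifs <;> simp
  have eσ : ∀ w : 𝒳 × ℝ, σ w * (μ' w.1 w.2 - μ w.1 w.2) = |μ' w.1 w.2 - μ w.1 w.2| := fun w => by
    simp only [hσ]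
    split_ifs with hle
    · rw [one_mul, abs_of_nonneg (sub_nonneg.2 hle)]
    · rw [abs_of_neg (sub_neg.2 (not_le.1 hle))]; ring
  have mG : Measurable (fun w => F w * σ w) := hF.mul mσ
  have hGY : Integrable (fun z : Obs 𝒳 => F (z.1, z.2.1) * σ (z.1, z.2.1) * z.2.2)
      (P : Measure (Obs 𝒳)) :=
    (hi.mul_bdd (c := 1) (mσ.comp measurable_covTreat).aestronglyMeasurable
      (ae_of_all _ fun z => bσ _)).congr (ae_of_all _ fun z => by
        simp only [Function.comp, covTreat]; ring)
  have hGμ := hμ.integrable_mul mG hGY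
  have hGμ' := hμ'.integrable_mul mG (hT.integrable hGY)
  have hd : Integrable (fun z : Obs 𝒳 => F (z.1, z.2.1) * σ (z.1, z.2.1) * (z.2.2 - μ z.1 z.2.1))
      (P : Measure (Obs 𝒳)) := (hGY.sub' hGμ).congr (ae_of_all _ fun z => by ring)
  -- The weighted residual has mean zero under `P`, so under `Q` only `r - 1`, of size `ε`,
  -- contributes.
  have hd0 : ∫ z, F (z.1, z.2.1) * σ (z.1, z.2.1) * (z.2.2 - μ z.1 z.2.1)
      ∂(P : Measure (Obs 𝒳)) = 0 := by
    simp only [mul_sub]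
    rw [integral_sub hGY hGμ, hμ.integral_mul mG hGY, sub_self]
  have ha : Integrable (fun z : Obs 𝒳 => F (z.1, z.2.1) * |z.2.2 - μ z.1 z.2.1|)
      (P : Measure (Obs 𝒳)) := by
    refine ((hi.sub' (hμ.integrable_mul hF hi)).abs).congr (ae_of_all _ fun z => ?_)
    simp only
    rw [← mul_sub, abs_mul, abs_of_nonneg (hF0 _)]
  refine ⟨(hGμ'.sub' (hT.integrable hGμ)).congr (ae_of_all _ fun z => ?_), ?_⟩
  · simp only
    rw [← eσ (z.1, z.2.1)]
    ring
  · have e1 : ∫ z, F (z.1, z.2.1) * |μ' z.1 z.2.1 - μ z.1 z.2.1| ∂(Q : Measure (Obs 𝒳)) =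
        ∫ z, F (z.1, z.2.1) * σ (z.1, z.2.1) * (z.2.2 - μ z.1 z.2.1) ∂(Q : Measure (Obs 𝒳)) := by
      have : (fun z : Obs 𝒳 => F (z.1, z.2.1) * |μ' z.1 z.2.1 - μ z.1 z.2.1|) = fun z =>
          F (z.1, z.2.1) * σ (z.1, z.2.1) * μ' z.1 z.2.1 -
            F (z.1, z.2.1) * σ (z.1, z.2.1) * μ z.1 z.2.1 := by
        ext z
        rw [← eσ (z.1, z.2.1)]
        ring
      rw [this, integral_sub hGμ' (hT.integrable hGμ), hμ'.integral_mul mG (hT.integrable hGY),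
        ← integral_sub (hT.integrable hGY) (hT.integrable hGμ)]
      simp only [mul_sub]
    have hrd : Integrable (fun z : Obs 𝒳 => (r z - 1) *
        (F (z.1, z.2.1) * σ (z.1, z.2.1) * (z.2.2 - μ z.1 z.2.1))) (P : Measure (Obs 𝒳)) :=
      hd.bdd_mul (c := ε) (hT.measurable.sub_const 1).aestronglyMeasurable hT.bound
    have e2 : ∫ z, r z * (F (z.1, z.2.1) * σ (z.1, z.2.1) * (z.2.2 - μ z.1 z.2.1))
        ∂(P : Measure (Obs 𝒳)) = ∫ z, (r z - 1) *
        (F (z.1, z.2.1) * σ (z.1, z.2.1) * (z.2.2 - μ z.1 z.2.1)) ∂(P : Measure (Obs 𝒳)) := by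
      have : (fun z : Obs 𝒳 => r z * (F (z.1, z.2.1) * σ (z.1, z.2.1) * (z.2.2 - μ z.1 z.2.1))) =
          fun z => (r z - 1) * (F (z.1, z.2.1) * σ (z.1, z.2.1) * (z.2.2 - μ z.1 z.2.1)) +
            F (z.1, z.2.1) * σ (z.1, z.2.1) * (z.2.2 - μ z.1 z.2.1) := by
        ext z; ring
      rw [this, integral_add hrd hd, hd0, add_zero]
    rw [e1, hT.integral_eq hε, e2, ← integral_const_mul]
    refine integral_mono_ae hrd (ha.const_mul _) ?_
    filter_upwards [hT.bound] with z hz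
    refine (le_abs_self _).trans ?_
    rw [abs_mul, abs_mul, abs_mul, abs_of_nonneg (hF0 _)]
    refine mul_le_mul hz ?_ (mul_nonneg (mul_nonneg (hF0 _) (abs_nonneg _)) (abs_nonneg _))
      ((abs_nonneg _).trans hz)
    exact mul_le_mul_of_nonneg_right (mul_le_of_le_one_right (hF0 _) (bσ _)) (abs_nonneg _)

end IsTilt

/-- Along a regular submodel, the Taylor remainder of the smoothed indicator at the propensity
score is of smaller order than the parameter. -/
theorem isLittleO_integral_taylorR2 {P : ProbabilityMeasure (Obs 𝒳)}
    {Q : ℝ → ProbabilityMeasure (Obs 𝒳)} {r : ℝ → Obs 𝒳 → ℝ} {M : ℝ} (hM : 0 ≤ M)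
    {S : ℝ → ℝ → ℝ} {t L : ℝ} (hS : ContDiff ℝ 2 (fun p => S p t))
    (hL : ∀ p, |dS S t p| ≤ L) {π : 𝒳 → ℝ → ℝ} (hπ : IsTreatmentDensity P π)
    (hT : ∀ᶠ s in 𝓝 (0 : ℝ), IsTilt P (Q s) (r s) (M * |s|) ∧ M * |s| ≤ 1 / 8)
    {v : 𝒳 × ℝ → ℝ} (hv : Measurable v)
    (hi : Integrable (fun w => π w.1 w.2 * v w) (baseMeasure P)) :
    (fun s => ∫ w, |v w| * |taylorR2 S t (π w.1 w.2) (propScore (Q s) w.1 w.2)|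
      ∂(baseMeasure P)) =o[𝓝 0] fun s => s := by
  have hL0 : 0 ≤ L := (abs_nonneg _).trans (hL 0)
  -- The propensity score of `Q s` is near `π` only off a null set depending on `s`, and uncountably
  -- many `s` are in play. Clamping it to the allowed interval makes the bound hold everywhere
  -- without changing any of the integrals for small `s`.
  set p : ℝ → 𝒳 × ℝ → ℝ := fun s w =>
    max (π w.1 w.2 - 4 * (M * |s|) * π w.1 w.2)
      (min (π w.1 w.2 + 4 * (M * |s|) * π w.1 w.2) (propScore (Q s) w.1 w.2)) with hp
  have mp : ∀ s, Measurable (p s) := fun s =>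
    (hπ.measurable.sub (hπ.measurable.const_mul _)).max
      ((hπ.measurable.add (hπ.measurable.const_mul _)).min
        (Measure.measurable_rnDeriv _ _).ennreal_toReal)
  have bp : ∀ s w, |p s w - π w.1 w.2| ≤ 4 * (M * |s|) * π w.1 w.2 := fun s w => by
    have h0 : 0 ≤ 4 * (M * |s|) * π w.1 w.2 := by have := hπ.nonneg w.1 w.2; positivity
    rw [abs_le]
    constructor
    · have := le_max_left (π w.1 w.2 - 4 * (M * |s|) * π w.1 w.2)
        (min (π w.1 w.2 + 4 * (M * |s|) * π w.1 w.2) (propScore (Q s) w.1 w.2))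
      simp only [hp]; linarith
    · have : p s w ≤ π w.1 w.2 + 4 * (M * |s|) * π w.1 w.2 :=
        max_le (by linarith) (min_le_left _ _)
      linarith
  have ep : ∀ᶠ s in 𝓝 (0 : ℝ), ∫ w, |v w| * |taylorR2 S t (π w.1 w.2) (propScore (Q s) w.1 w.2)|
      ∂(baseMeasure P) = ∫ w, |v w| * |taylorR2 S t (π w.1 w.2) (p s w)| ∂(baseMeasure P) := by
    filter_upwards [hT] with s hs
    refine integral_congr_ae ?_
    filter_upwards [hs.1.abs_propScore_sub_le (by positivity) hs.2 hπ] with w hw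
    have : p s w = propScore (Q s) w.1 w.2 := by
      have := abs_le.1 hw
      simp only [hp]
      rw [min_eq_right (by linarith), max_eq_right (by linarith)]
    rw [this]
  refine Asymptotics.IsLittleO.congr' ?_ (ep.mono fun s hs => hs.symm) (EventuallyEq.refl _ _)
  have mT : ∀ s, Measurable (fun w : 𝒳 × ℝ => taylorR2 S t (π w.1 w.2) (p s w)) := fun s => by
    have m1 : Measurable (fun q => S q t) := hS.continuous.measurable
    have m2 : Measurable (dS S t) := (continuous_dS hS).measurable
    exact ((m1.comp (mp s)).sub (m1.comp hπ.measurable)).sub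
      ((m2.comp hπ.measurable).mul ((mp s).sub hπ.measurable))
  have hlim : Tendsto (fun s => ∫ w, |v w| * |taylorR2 S t (π w.1 w.2) (p s w)| / s
      ∂(baseMeasure P)) (𝓝[≠] 0) (𝓝 (∫ _, (0 : ℝ) ∂(baseMeasure P))) := by
    refine tendsto_integral_filter_of_dominated_convergence
      -- The Lipschitz bound `2 L` times the clamp width `4 M |s| π`, divided by `|s|`.
      (fun w => 8 * L * M * |π w.1 w.2 * v w|) ?_ ?_ (hi.abs.const_mul _) ?_
    · exact Eventually.of_forall fun s => ((hv.abs.fun_mul (mT s).abs).div_const s).aestronglyMeasurable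
    · filter_upwards [self_mem_nhdsWithin] with s hs
      refine ae_of_all _ fun w => ?_
      have hs0 : s ≠ 0 := hs
      rw [Real.norm_eq_abs, abs_div, abs_mul, abs_abs, abs_abs, div_le_iff₀ (abs_pos.2 hs0),
        abs_mul, abs_of_nonneg (hπ.nonneg w.1 w.2)]
      have h1 := abs_taylorR2_le_lipschitz hS hL (π w.1 w.2) (p s w)
      have h2 : |taylorR2 S t (π w.1 w.2) (p s w)| ≤ 2 * L * (4 * (M * |s|) * π w.1 w.2) :=
        h1.trans (mul_le_mul_of_nonneg_left (bp s w) (by positivity))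
      have := mul_le_mul_of_nonneg_left h2 (abs_nonneg (v w))
      linarith
    · refine ae_of_all _ fun w => ?_
      have hpl : Tendsto (fun s => p s w) (𝓝 0) (𝓝 (π w.1 w.2)) := by
        rw [tendsto_iff_norm_sub_tendsto_zero]
        refine squeeze_zero (fun _ => norm_nonneg _) (fun s => bp s w) ?_
        have : Tendsto (fun s : ℝ => 4 * (M * |s|) * π w.1 w.2) (𝓝 0)
            (𝓝 (4 * (M * |(0 : ℝ)|) * π w.1 w.2)) := by
          apply Continuous.tendsto; fun_prop
        simpa using this
      have hd := (hasDerivAt_iff_isLittleO.1 (hasDerivAt_dS hS (π w.1 w.2))).comp_tendsto hpl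
      have hO : (fun s => p s w - π w.1 w.2) =O[𝓝 0] fun s : ℝ => s := by
        refine Asymptotics.IsBigO.of_bound (4 * M * π w.1 w.2) (Eventually.of_forall fun s => ?_)
        have := bp s w
        rw [Real.norm_eq_abs, Real.norm_eq_abs]
        linarith
      have hd2 : (fun s => taylorR2 S t (π w.1 w.2) (p s w)) =o[𝓝 0] fun s : ℝ => s := by
        refine (hd.trans_isBigO hO).congr_left fun s => ?_
        simp only [Function.comp, taylorR2, smul_eq_mul]
        ring
      have hd3 := ((hd2.abs_left.const_mul_left |v w|).tendsto_div_nhds_zero).mono_left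
        (nhdsWithin_le_nhds (s := {0}ᶜ))
      exact hd3
  rw [integral_zero] at hlim
  have hlim2 : Tendsto (fun s => (∫ w, |v w| * |taylorR2 S t (π w.1 w.2) (p s w)|
      ∂(baseMeasure P)) / s) (𝓝[≠] 0) (𝓝 0) := by
    refine hlim.congr fun s => ?_
    rw [integral_div]
  have h0 : ∫ w, |v w| * |taylorR2 S t (π w.1 w.2) (p 0 w)| ∂(baseMeasure P) = 0 := by
    have : ∀ w, p 0 w = π w.1 w.2 := fun w => by
      have := bp 0 w
      simpa [sub_eq_zero] using this
    simp [this, taylorR2]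
  rw [Asymptotics.isLittleO_iff_tendsto' (Eventually.of_forall fun s hs => by rw [hs]; exact h0)]
  -- The quotient takes the value `0` at `s = 0` by the convention `x / 0 = 0`, so the punctured
  -- limit is continuity at `0`.
  have hc := continuousAt_iff_punctured_nhds (a := (0 : ℝ)) (f := fun s =>
    (∫ w, |v w| * |taylorR2 S t (π w.1 w.2) (p s w)| ∂(baseMeasure P)) / s)
  simp only [div_zero] at hc
  simpa [ContinuousAt] using hc.2 hlim2

/-! ### Influence functions of the two estimands -/

/-- Reduces the pathwise derivative to a remainder estimate: `ψ (Q s)` is the mean of the fixed `φ`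
under `Q s`, with derivative `E[ξ g]`, minus a term of derivative zero. -/
theorem isInfluenceFunction_of_remainder {Z : Type*} [MeasurableSpace Z]
    {P : ProbabilityMeasure Z} {ψ : ProbabilityMeasure Z → ℝ} {φ : Z → ℝ}
    (hφ : MemLp φ 2 (P : Measure Z)) (hmean : ∫ z, φ z ∂(P : Measure Z) = ψ P)
    (hrem : ∀ (Q : ℝ → ProbabilityMeasure Z) (r : ℝ → Z → ℝ) (M : ℝ), 0 ≤ M →
      (∀ᶠ s in 𝓝 (0 : ℝ), IsTilt P (Q s) (r s) (M * |s|) ∧ M * |s| ≤ 1 / 8) →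
      (fun s => ∫ z, φ z ∂(Q s : Measure Z) - ψ (Q s)) =o[𝓝 0] fun s => s) :
    IsInfluenceFunction ψ P (fun z => φ z - ψ P) := by
  have hξ : MemLp (fun z => φ z - ψ P) 2 (P : Measure Z) := hφ.sub (memLp_const _)
  have hφi := hφ.integrable (by norm_num)
  refine ⟨hξ, ?_, ?_⟩
  · rw [integral_sub hφi (integrable_const _), hmean]
    simp
  · rintro Q g ⟨hg, r, M, hr, hlim⟩
    have hT : ∀ᶠ s in 𝓝 (0 : ℝ), IsTilt P (Q s) (r s) (|M| * |s|) := by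
      filter_upwards [hr] with s hs
      refine ⟨hs.1, hs.2.1, ?_⟩
      filter_upwards [hs.2.2] with z hz
      exact hz.trans (mul_le_mul_of_nonneg_right (le_abs_self _) (abs_nonneg _))
    have hsmall : ∀ᶠ s in 𝓝 (0 : ℝ), |M| * |s| ≤ 1 / 8 := by
      have : Tendsto (fun s : ℝ => |M| * |s|) (𝓝 0) (𝓝 (|M| * |(0 : ℝ)|)) := by
        apply Continuous.tendsto; fun_prop
      exact this.eventually_le_const (by simp)
    have hd := hasDerivAt_integral_of_likelihood hg hT hlim hξ
    have hR := hrem Q r |M| (abs_nonneg _) (hT.and hsmall)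
    -- The little-o holds on a full neighbourhood, so the remainder vanishes at `s = 0` itself.
    have hR0 : ∫ z, φ z ∂(Q 0 : Measure Z) - ψ (Q 0) = 0 :=
      (hR.isBigO.eq_zero_imp).self_of_nhds rfl
    have hRd : HasDerivAt (fun s => ∫ z, φ z ∂(Q s : Measure Z) - ψ (Q s)) 0 0 := by
      rw [hasDerivAt_iff_isLittleO]
      simpa [hR0] using hR
    refine ((hd.sub hRd).add_const (ψ P)).congr_of_eventuallyEq ?_ |>.congr_deriv (sub_zero _)
    filter_upwards [hT] with s hs
    simp only [Pi.sub_apply]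
    rw [integral_sub (hs.integrable hφi) (integrable_const _)]
    simp

section

variable {K : ℝ → ℝ} {h a : ℝ} {S : ℝ → ℝ → ℝ} {t L : ℝ}

/-- Conditions on the nuisances of `P` pass to `Q` because `Q ≤ (1 + ε) P`. Those involving `outReg
Q` come from conditional expectations under `Q`, whose weight `propScore Q` dominates `π / 2`. -/
theorem IsTilt.crossIntegrable (hK : IsKernel K) (hS : ContDiff ℝ 2 (fun p => S p t))
    (hL : ∀ p, |dS S t p| ≤ L) {P Q : ProbabilityMeasure (Obs 𝒳)} {r : Obs 𝒳 → ℝ} {ε : ℝ}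
    (hT : IsTilt P Q r ε) (hε0 : 0 ≤ ε) (hε : ε ≤ 1 / 8) {π μ : 𝒳 → ℝ → ℝ}
    (hπ : IsTreatmentDensity P π) (hμ : IsOutcomeRegression P μ)
    (hr : NumRegular K h a S t P π) :
    CrossIntegrable K h a S t Q (outReg Q) π μ ∧
    (∀ᵐ w ∂(kernelMeasure K h a Q), 0 < propScore Q w.1 w.2) ∧
    Integrable (fun w : 𝒳 × ℝ => scaledKernel K h (w.2 - a) * outReg Q w.1 w.2 *
      S (propScore Q w.1 w.2) t) (baseMeasure Q) := by
  have hc := hr.crossIntegrable_self hK hS hπ hμ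
  have hQ := hT.isTreatmentDensity_propScore hε hπ
  have hR : IsOutcomeRegression Q (outReg Q) :=
    isOutcomeRegression_outReg (hT.integrable hμ.integrable)
  have mk : Measurable (fun w : 𝒳 × ℝ => scaledKernel K h (w.2 - a)) := hK.measurable_scaledKernel
  have mS : Measurable (fun w : 𝒳 × ℝ => S (π w.1 w.2) t) :=
    hS.continuous.measurable.comp hπ.measurable
  have mF : Measurable (fun w : 𝒳 × ℝ => scaledKernel K h (w.2 - a) * S (π w.1 w.2) t /
      π w.1 w.2) := (mk.mul mS).div hπ.measurable
  obtain ⟨B, -, hB⟩ := hK.exists_abs_scaledKernel_le (h := h)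
  have hpos : ∀ᵐ w ∂(baseMeasure Q), scaledKernel K h (w.2 - a) ≠ 0 → 0 < π w.1 w.2 :=
    hT.baseMeasure_absolutelyContinuous.ae_le ((ae_kernelMeasure_iff hK).1 hr.positivity)
  have hclose : ∀ᵐ w ∂(baseMeasure Q), π w.1 w.2 ≤ 2 * propScore Q w.1 w.2 := by
    refine hT.baseMeasure_absolutelyContinuous.ae_le ?_
    filter_upwards [hT.abs_propScore_sub_le hε0 hε hπ] with w hw
    have h1 := (abs_le.1 hw).1
    have h2 : ε * π w.1 w.2 ≤ 1 / 8 * π w.1 w.2 := mul_le_mul_of_nonneg_right hε (hπ.nonneg _ _)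
    linarith
  have i7 : Integrable (fun w : 𝒳 × ℝ => propScore Q w.1 w.2 *
      (scaledKernel K h (w.2 - a) * outReg Q w.1 w.2)) (baseMeasure Q) :=
    (hQ.integrable_iff (mk.fun_mul hR.measurable)).1 <| hR.integrable_mul mk <|
      hR.integrable.bdd_mul (c := B) (mk.comp measurable_covTreat).aestronglyMeasurable
        (ae_of_all _ fun z => hB _)
  have i6 : Integrable (fun w : 𝒳 × ℝ => scaledKernel K h (w.2 - a) *
      (π w.1 w.2 * outReg Q w.1 w.2)) (baseMeasure Q) := by
    refine integrable_of_abs_le (i7.abs.const_mul 2)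
      (mk.fun_mul (hπ.measurable.fun_mul hR.measurable)) ?_
    filter_upwards [hclose] with w hw
    simp only [abs_mul]
    rw [abs_of_nonneg (hπ.nonneg w.1 w.2), abs_of_nonneg (hQ.nonneg w.1 w.2)]
    have := mul_le_mul_of_nonneg_left hw
      (mul_nonneg (abs_nonneg (scaledKernel K h (w.2 - a))) (abs_nonneg (outReg Q w.1 w.2)))
    linarith
  have hk : ∀ {F : 𝒳 × ℝ → ℝ}, Measurable F → Integrable F (kernelMeasure K h a P) →
      Integrable F (kernelMeasure K h a Q) := fun hF hi =>
    (integrable_kernelMeasure_iff hK hF).2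
      (hT.integrable_baseMeasure ((integrable_kernelMeasure_iff hK hF).1 hi))
  refine ⟨⟨(ae_kernelMeasure_iff hK).2 hpos, hT.integrable hc.weighted_outcome,
    hT.integrable hc.weighted_regression, hT.integrable hc.regression,
    hk (mS.fun_mul hμ.measurable) hc.trimmed, hk (hπ.measurable.fun_mul hμ.measurable) hc.product,
    (integrable_kernelMeasure_iff hK (hπ.measurable.fun_mul hR.measurable)).2 i6⟩,
    (ae_kernelMeasure_iff hK).2 ?_, ?_⟩
  · filter_upwards [hpos, hclose] with w h1 h2 h0
    have := h1 h0
    linarith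
  · have w1 : Integrable (fun z : Obs 𝒳 => scaledKernel K h (z.2.1 - a) * S (π z.1 z.2.1) t /
        π z.1 z.2.1 * z.2.2) (Q : Measure (Obs 𝒳)) :=
      (hT.integrable hc.weighted_outcome).congr (ae_of_all _ fun z => by ring)
    have i1 := (hQ.integrable_iff (mF.fun_mul hR.measurable)).1 (hR.integrable_mul mF w1)
    have i9 : Integrable (fun w : 𝒳 × ℝ => scaledKernel K h (w.2 - a) * outReg Q w.1 w.2 *
        S (π w.1 w.2) t) (baseMeasure Q) := by
      refine integrable_of_abs_le (i1.abs.const_mul 2)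
        ((mk.fun_mul hR.measurable).fun_mul mS) ?_
      filter_upwards [hpos, hclose] with w h1 h2
      by_cases h0 : scaledKernel K h (w.2 - a) = 0
      · simp [h0]
      · have hp := h1 h0
        simp only [abs_mul, abs_div]
        rw [abs_of_pos hp, abs_of_nonneg (hQ.nonneg w.1 w.2)]
        have h3 : 1 ≤ 2 * (propScore Q w.1 w.2 / π w.1 w.2) := by
          rw [← mul_div_assoc, le_div_iff₀ hp]; linarith
        have := mul_le_mul_of_nonneg_left h3 (mul_nonneg (mul_nonneg
          (abs_nonneg (scaledKernel K h (w.2 - a))) (abs_nonneg (outReg Q w.1 w.2)))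
          (abs_nonneg (S (π w.1 w.2) t)))
        refine (this.trans_eq ?_).trans' (by rw [mul_one])
        ring
    exact TrimmedEffect.integrable_mul_smoothing hS hL (mk.fun_mul hR.measurable) hQ.measurable i9
      (i6.congr (ae_of_all _ fun w => by ring)) (i7.congr (ae_of_all _ fun w => by ring))

/-- Along a tilt, the remainder of the numerator is of second order in the size of the tilt, up to
a Taylor remainder of the smoothed indicator. -/
theorem IsTilt.abs_integral_phiNum_sub_le (hK : IsKernel K) (hS : ContDiff ℝ 2 (fun p => S p t))
    (hL : ∀ p, |dS S t p| ≤ L) {P Q : ProbabilityMeasure (Obs 𝒳)} {r : Obs 𝒳 → ℝ} {ε : ℝ}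
    (hT : IsTilt P Q r ε) (hε0 : 0 ≤ ε) (hε : ε ≤ 1 / 8) {π μ : 𝒳 → ℝ → ℝ}
    (hπ : IsTreatmentDensity P π) (hμ : IsOutcomeRegression P μ)
    (hr : NumRegular K h a S t P π) :
    |∫ z, phiNum K h a S t π μ z ∂(Q : Measure (Obs 𝒳)) - psiNum K h a S t Q| ≤
      ε ^ 2 * (8 * (∫ z : Obs 𝒳, |scaledKernel K h (z.2.1 - a) * (S (π z.1 z.2.1) t / π z.1 z.2.1 -
          dS S t (π z.1 z.2.1))| * |z.2.2 - μ z.1 z.2.1| ∂(P : Measure (Obs 𝒳))) +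
        16 * L * ∫ z : Obs 𝒳, |scaledKernel K h (z.2.1 - a)| * |z.2.2 - μ z.1 z.2.1|
          ∂(P : Measure (Obs 𝒳))) +
      2 * ∫ w : 𝒳 × ℝ, |scaledKernel K h (w.2 - a) * μ w.1 w.2| *
        |taylorR2 S t (π w.1 w.2) (propScore Q w.1 w.2)| ∂(baseMeasure P) := by
  have hL0 : 0 ≤ L := (abs_nonneg _).trans (hL 0)
  have hQ := hT.isTreatmentDensity_propScore hε hπ
  have hR : IsOutcomeRegression Q (outReg Q) :=
    isOutcomeRegression_outReg (hT.integrable hμ.integrable)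
  obtain ⟨hcQ, hposQ, hS1⟩ := hT.crossIntegrable hK hS hL hε0 hε hπ hμ hr
  obtain ⟨-, hint, iA, iB⟩ := integrable_phiNum_and_integral hK hS hL hQ hR hposQ hπ.measurable
    hμ.measurable hcQ hS1
  rw [hint, add_sub_cancel_left, remNum_eq iA iB]
  have hc := hr.crossIntegrable_self hK hS hπ hμ
  have mk : Measurable (fun w : 𝒳 × ℝ => scaledKernel K h (w.2 - a)) := hK.measurable_scaledKernel
  have mS : Measurable (fun w : 𝒳 × ℝ => S (π w.1 w.2) t) :=
    hS.continuous.measurable.comp hπ.measurable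
  have mD : Measurable (fun w : 𝒳 × ℝ => dS S t (π w.1 w.2)) :=
    (continuous_dS hS).measurable.comp hπ.measurable
  obtain ⟨B, -, hB⟩ := hK.exists_abs_scaledKernel_le (h := h)
  set F : 𝒳 × ℝ → ℝ := fun w => |scaledKernel K h (w.2 - a) * (S (π w.1 w.2) t / π w.1 w.2 -
          dS S t (π w.1 w.2))| with hF
  have mF : Measurable F := (mk.mul ((mS.div hπ.measurable).sub mD)).abs
  have ikY : Integrable (fun z : Obs 𝒳 => scaledKernel K h (z.2.1 - a) * z.2.2)
      (P : Measure (Obs 𝒳)) :=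
    hμ.integrable.bdd_mul (c := B) (mk.comp measurable_covTreat).aestronglyMeasurable
      (ae_of_all _ fun z => hB _)
  have iFY : Integrable (fun z : Obs 𝒳 => F (z.1, z.2.1) * z.2.2) (P : Measure (Obs 𝒳)) := by
    have i1 : Integrable (fun z : Obs 𝒳 => scaledKernel K h (z.2.1 - a) * z.2.2 *
        dS S t (π z.1 z.2.1)) (P : Measure (Obs 𝒳)) :=
      integrable_mul_dS hS hL ikY (hπ.measurable.comp measurable_covTreat)
    refine integrable_of_abs_le (hc.weighted_outcome.sub' i1).abs
      ((mF.comp measurable_covTreat).mul measurable_outcome) (ae_of_all _ fun z => le_of_eq ?_)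
    simp only [hF, abs_mul, abs_abs]
    rw [← abs_mul, ← abs_mul]
    congr 1
    ring
  have ikY' : Integrable (fun z : Obs 𝒳 => |scaledKernel K h (z.2.1 - a)| * z.2.2)
      (P : Measure (Obs 𝒳)) :=
    hμ.integrable.bdd_mul (c := B) (mk.abs.comp measurable_covTreat).aestronglyMeasurable
      (ae_of_all _ fun z => by simpa using hB _)
  obtain ⟨j1, b1⟩ := hT.integral_abs_outReg_sub_le (by linarith) hμ hR mF
    (fun w => abs_nonneg _) iFY
  obtain ⟨j2, b2⟩ := hT.integral_abs_outReg_sub_le (by linarith) hμ hR mk.abs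
    (fun w => abs_nonneg _) ikY'
  have mΔ : Measurable (fun w : 𝒳 × ℝ => |outReg Q w.1 w.2 - μ w.1 w.2|) :=
    (hR.measurable.sub hμ.measurable).abs
  have j1' := (hQ.integrable_iff (mF.fun_mul mΔ)).1 j1
  have j2' := (hQ.integrable_iff (mk.abs.fun_mul mΔ)).1 j2
  have e1 := hQ.integral_eq (mF.fun_mul mΔ)
  have e2 := hQ.integral_eq (mk.abs.fun_mul mΔ)
  simp only at e1 e2 b2
  rw [e1] at b1
  rw [e2] at b2
  -- The error is expressed relative to the density of `Q`, so that integrals against it become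
  -- means under `Q`. The factor 8 is `4 ε π` with `π ≤ 2 π_Q`.
  have hclose : ∀ᵐ w ∂(baseMeasure Q), |propScore Q w.1 w.2 - π w.1 w.2| ≤
      8 * ε * propScore Q w.1 w.2 := by
    refine hT.baseMeasure_absolutelyContinuous.ae_le ?_
    filter_upwards [hT.abs_propScore_sub_le hε0 hε hπ] with w hw
    have h1 := (abs_le.1 hw).1
    have h2 : ε * π w.1 w.2 ≤ 1 / 8 * π w.1 w.2 := mul_le_mul_of_nonneg_right hε (hπ.nonneg _ _)
    have h3 : π w.1 w.2 ≤ 2 * propScore Q w.1 w.2 := by linarith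
    have := mul_le_mul_of_nonneg_left h3 hε0
    linarith
  have mT : Measurable (fun w : 𝒳 × ℝ => taylorR2 S t (π w.1 w.2) (propScore Q w.1 w.2)) :=
    ((hS.continuous.measurable.comp hQ.measurable).sub mS).sub
      (mD.mul (hQ.measurable.sub hπ.measurable))
  have ikμ : Integrable (fun w : 𝒳 × ℝ => π w.1 w.2 * (scaledKernel K h (w.2 - a) * μ w.1 w.2))
      (baseMeasure P) := (hπ.integrable_iff (mk.fun_mul hμ.measurable)).1 hc.regression
  have iT : Integrable (fun w : 𝒳 × ℝ => |scaledKernel K h (w.2 - a) * μ w.1 w.2| *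
        |taylorR2 S t (π w.1 w.2) (propScore Q w.1 w.2)|) (baseMeasure P) := by
    refine integrable_of_abs_le (ikμ.abs.const_mul L)
      ((mk.fun_mul hμ.measurable).abs.fun_mul mT.abs) ?_
    filter_upwards [hT.abs_propScore_sub_le hε0 hε hπ] with w hw
    have h1 := abs_taylorR2_le_lipschitz hS hL (π w.1 w.2) (propScore Q w.1 w.2)
    have h2 : ε * π w.1 w.2 ≤ 1 / 8 * π w.1 w.2 := mul_le_mul_of_nonneg_right hε (hπ.nonneg _ _)
    have h3 : |taylorR2 S t (π w.1 w.2) (propScore Q w.1 w.2)| ≤ L * π w.1 w.2 := by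
      refine h1.trans ?_
      have := mul_le_mul_of_nonneg_left (hw.trans (by linarith : _ ≤ 1 / 2 * π w.1 w.2)) hL0
      linarith
    rw [abs_mul, abs_abs, abs_abs, abs_mul (π w.1 w.2), abs_of_nonneg (hπ.nonneg w.1 w.2)]
    have := mul_le_mul_of_nonneg_left h3 (abs_nonneg (scaledKernel K h (w.2 - a) * μ w.1 w.2))
    linarith
  have hA : |∫ w : 𝒳 × ℝ, scaledKernel K h (w.2 - a) *
        (S (π w.1 w.2) t / π w.1 w.2 - dS S t (π w.1 w.2)) *
          (propScore Q w.1 w.2 - π w.1 w.2) * (outReg Q w.1 w.2 - μ w.1 w.2) ∂(baseMeasure Q)| ≤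
      8 * ε * ∫ w : 𝒳 × ℝ, propScore Q w.1 w.2 * (F w * |outReg Q w.1 w.2 - μ w.1 w.2|)
        ∂(baseMeasure Q) := by
    refine (abs_integral_le_integral_abs).trans ?_
    rw [← integral_const_mul]
    refine integral_mono_ae iA.abs (j1'.const_mul _) ?_
    filter_upwards [hclose] with w hw
    rw [abs_mul, abs_mul]
    have := mul_le_mul_of_nonneg_left hw (mul_nonneg (abs_nonneg (scaledKernel K h (w.2 - a) *
        (S (π w.1 w.2) t / π w.1 w.2 - dS S t (π w.1 w.2))))
        (abs_nonneg (outReg Q w.1 w.2 - μ w.1 w.2)))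
    simp only [hF]
    linarith
  -- Split `|outReg Q| ≤ |μ| + |outReg Q - μ|`. The first part keeps the Taylor remainder, treated
  -- later by dominated convergence; in the second the Lipschitz bound `2 L * 8 ε π_Q` meets a
  -- regression error of order `ε`.
  have hBd : |∫ w : 𝒳 × ℝ, scaledKernel K h (w.2 - a) * outReg Q w.1 w.2 *
        taylorR2 S t (π w.1 w.2) (propScore Q w.1 w.2) ∂(baseMeasure Q)| ≤
      (∫ w : 𝒳 × ℝ, |scaledKernel K h (w.2 - a) * μ w.1 w.2| *
        |taylorR2 S t (π w.1 w.2) (propScore Q w.1 w.2)| ∂(baseMeasure Q)) +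
      16 * L * ε * ∫ w : 𝒳 × ℝ, propScore Q w.1 w.2 * (|scaledKernel K h (w.2 - a)| *
        |outReg Q w.1 w.2 - μ w.1 w.2|) ∂(baseMeasure Q) := by
    have iTQ := hT.integrable_baseMeasure iT
    refine (abs_integral_le_integral_abs).trans ?_
    rw [← integral_const_mul, ← integral_add iTQ (j2'.const_mul _)]
    refine integral_mono_ae iB.abs (iTQ.fun_add (j2'.const_mul _)) ?_
    filter_upwards [hclose] with w hw
    rw [abs_mul, abs_mul, abs_mul]
    have h1 := abs_taylorR2_le_lipschitz hS hL (π w.1 w.2) (propScore Q w.1 w.2)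
    have h2 : |taylorR2 S t (π w.1 w.2) (propScore Q w.1 w.2)| ≤
        16 * L * ε * propScore Q w.1 w.2 := by
      have := mul_le_mul_of_nonneg_left hw hL0
      linarith
    have h3 : |outReg Q w.1 w.2| ≤ |μ w.1 w.2| + |outReg Q w.1 w.2 - μ w.1 w.2| := by
      have := abs_sub_abs_le_abs_sub (outReg Q w.1 w.2) (μ w.1 w.2)
      linarith
    have h4 := mul_le_mul_of_nonneg_left h3 (mul_nonneg (abs_nonneg (scaledKernel K h (w.2 - a)))
      (abs_nonneg (taylorR2 S t (π w.1 w.2) (propScore Q w.1 w.2))))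
    have h5 := mul_le_mul_of_nonneg_left h2 (mul_nonneg (abs_nonneg (scaledKernel K h (w.2 - a)))
      (abs_nonneg (outReg Q w.1 w.2 - μ w.1 w.2)))
    linarith
  have hC : ∫ w : 𝒳 × ℝ, |scaledKernel K h (w.2 - a) * μ w.1 w.2| *
        |taylorR2 S t (π w.1 w.2) (propScore Q w.1 w.2)| ∂(baseMeasure Q) ≤
      2 * ∫ w : 𝒳 × ℝ, |scaledKernel K h (w.2 - a) * μ w.1 w.2| *
        |taylorR2 S t (π w.1 w.2) (propScore Q w.1 w.2)| ∂(baseMeasure P) :=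
    hT.integral_le_two_mul hε (fun w => by positivity) iT
  have h6 := mul_le_mul_of_nonneg_left b1 (by positivity : 0 ≤ 8 * ε)
  have h7 := mul_le_mul_of_nonneg_left b2 (by positivity : 0 ≤ 16 * L * ε)
  refine (abs_sub _ _).trans ?_
  calc _ ≤ _ := add_le_add (hA.trans h6) (hBd.trans (add_le_add hC h7))
    _ = _ := by simp only [hF]; ring

/-- Along a tilt, the remainder of the denominator is a Taylor remainder of the smoothed
indicator. -/
theorem IsTilt.abs_integral_phiDen_sub_le (hK : IsKernel K) (hh : 0 < h)
    (hS : ContDiff ℝ 2 (fun p => S p t))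
    (hL : ∀ p, |dS S t p| ≤ L) {P Q : ProbabilityMeasure (Obs 𝒳)} {r : Obs 𝒳 → ℝ} {ε : ℝ}
    (hT : IsTilt P Q r ε) (hε0 : 0 ≤ ε) (hε : ε ≤ 1 / 8) {π : 𝒳 → ℝ → ℝ}
    (hπ : IsTreatmentDensity P π) :
    |∫ z, phiDen K h a S t π z ∂(Q : Measure (Obs 𝒳)) - psiDen K h a S t Q| ≤
      2 * ∫ w : 𝒳 × ℝ, |scaledKernel K h (w.2 - a)| *
        |taylorR2 S t (π w.1 w.2) (propScore Q w.1 w.2)| ∂(baseMeasure P) := by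
  have hL0 : 0 ≤ L := (abs_nonneg _).trans (hL 0)
  have hQ := hT.isTreatmentDensity_propScore hε hπ
  have mk : Measurable (fun w : 𝒳 × ℝ => scaledKernel K h (w.2 - a)) := hK.measurable_scaledKernel
  obtain ⟨B, -, hB⟩ := hK.exists_abs_scaledKernel_le (h := h)
  have ip : Integrable (fun w : 𝒳 × ℝ => scaledKernel K h (w.2 - a) * π w.1 w.2)
      (baseMeasure P) := hπ.integrable.bdd_mul (c := B) mk.aestronglyMeasurable
        (ae_of_all _ fun w => hB _)
  obtain ⟨-, hint, iB⟩ := integrable_phiDen_and_integral (a := a) hK hh hS hL hQ hπ.measurable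
    (hT.integrable_baseMeasure ip)
  rw [hint, add_sub_cancel_left, remDen_eq iB, abs_neg]
  have mT : Measurable (fun w : 𝒳 × ℝ => taylorR2 S t (π w.1 w.2) (propScore Q w.1 w.2)) :=
    ((hS.continuous.measurable.comp hQ.measurable).sub
      (hS.continuous.measurable.comp hπ.measurable)).sub
      (((continuous_dS hS).measurable.comp hπ.measurable).mul (hQ.measurable.sub hπ.measurable))
  have iT : Integrable (fun w : 𝒳 × ℝ => |scaledKernel K h (w.2 - a)| *
        |taylorR2 S t (π w.1 w.2) (propScore Q w.1 w.2)|) (baseMeasure P) := by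
    refine integrable_of_abs_le (ip.abs.const_mul L) (mk.abs.fun_mul mT.abs) ?_
    filter_upwards [hT.abs_propScore_sub_le hε0 hε hπ] with w hw
    have h1 := abs_taylorR2_le_lipschitz hS hL (π w.1 w.2) (propScore Q w.1 w.2)
    have h2 : ε * π w.1 w.2 ≤ 1 / 8 * π w.1 w.2 := mul_le_mul_of_nonneg_right hε (hπ.nonneg _ _)
    have h3 : |taylorR2 S t (π w.1 w.2) (propScore Q w.1 w.2)| ≤ L * π w.1 w.2 := by
      refine h1.trans ?_
      have := mul_le_mul_of_nonneg_left (hw.trans (by linarith : _ ≤ 1 / 2 * π w.1 w.2)) hL0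
      linarith
    rw [abs_mul, abs_abs, abs_abs, abs_mul _ (π w.1 w.2), abs_of_nonneg (hπ.nonneg w.1 w.2)]
    have := mul_le_mul_of_nonneg_left h3 (abs_nonneg (scaledKernel K h (w.2 - a)))
    linarith
  refine (abs_integral_le_integral_abs).trans ?_
  simp only [abs_mul]
  exact hT.integral_le_two_mul hε (fun w => by positivity) iT

/-- The conditional mean given `X` of a square-integrable function of `(X, A)` is square
integrable. -/
theorem IsTreatmentDensity.memLp_integral {P : ProbabilityMeasure (Obs 𝒳)} {π : 𝒳 → ℝ → ℝ}
    (hπ : IsTreatmentDensity P π) {F : 𝒳 × ℝ → ℝ} (hF : Measurable F)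
    (hL2 : MemLp (fun z : Obs 𝒳 => F (z.1, z.2.1)) 2 (P : Measure (Obs 𝒳))) :
    MemLp (fun z : Obs 𝒳 => ∫ a₀, π z.1 a₀ * F (z.1, a₀)) 2 (P : Measure (Obs 𝒳)) := by
  have hi := hL2.integrable (by norm_num)
  have hi' := (hπ.integrable_iff hF).1 hi
  have hf := hi'.integral_prod_left
  have hfi := (integrable_fst_iff hf.1).2 hf
  have hle : MeasurableSpace.comap (Prod.fst : Obs 𝒳 → 𝒳) inferInstance ≤
      (inferInstance : MeasurableSpace (Obs 𝒳)) := measurable_fst.comap_le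
  have hm : StronglyMeasurable[MeasurableSpace.comap (Prod.fst : Obs 𝒳 → 𝒳) inferInstance]
      (fun z : Obs 𝒳 => ∫ a₀, π z.1 a₀ * F (z.1, a₀)) := by
    have : StronglyMeasurable (fun x : 𝒳 => ∫ a₀, π x a₀ * F (x, a₀)) :=
      StronglyMeasurable.integral_prod_right
        (f := fun x a₀ => π x a₀ * F (x, a₀)) (hπ.measurable.mul hF).stronglyMeasurable
    exact this.comp_measurable (comap_measurable Prod.fst)
  -- The inner integral is a version of the conditional expectation given `X`, which preserves
  -- square integrability.
  have hae := ae_eq_condExp_of_forall_setIntegral_eq hle hi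
    (g := fun z : Obs 𝒳 => ∫ a₀, π z.1 a₀ * F (z.1, a₀)) (fun s _ _ => hfi.integrableOn)
    (fun s hs _ => by
      obtain ⟨A, hA, rfl⟩ := hs
      have hA' : MeasurableSet (Prod.fst ⁻¹' A : Set (𝒳 × ℝ)) := measurable_fst hA
      have h1 : ∫ z in Prod.fst ⁻¹' A, F (z.1, z.2.1) ∂(P : Measure (Obs 𝒳)) =
          ∫ w, π w.1 w.2 * (Prod.fst ⁻¹' A : Set (𝒳 × ℝ)).indicator F w ∂(baseMeasure P) := by
        rw [← hπ.integral_eq (hF.indicator hA'), ← integral_indicator (measurable_fst hA)]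
        rfl
      have hind : Integrable (fun w => π w.1 w.2 *
          (Prod.fst ⁻¹' A : Set (𝒳 × ℝ)).indicator F w) (baseMeasure P) := by
        refine (hi'.indicator hA').congr (ae_of_all _ fun w => ?_)
        by_cases hw : w ∈ (Prod.fst ⁻¹' A : Set (𝒳 × ℝ)) <;> simp [hw]
      have h2 : ∫ z in Prod.fst ⁻¹' A, (∫ a₀, π z.1 a₀ * F (z.1, a₀)) ∂(P : Measure (Obs 𝒳)) =
          ∫ x in A, (∫ a₀, π x a₀ * F (x, a₀)) ∂(covLaw P) :=
        (setIntegral_map hA hf.1 measurable_fst.aemeasurable).symm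
      rw [h1, h2, integral_prod _ hind, ← integral_indicator hA]
      congr 1
      ext x
      by_cases hx : x ∈ A <;> simp [hx])
    hm.aestronglyMeasurable
  exact (memLp_congr_ae hae).2 (hL2.condExp (by norm_num))

theorem memLp_mul_of_abs_le {α : Type*} [MeasurableSpace α] {ν : Measure α} {f g : α → ℝ} {C : ℝ}
    (hf : MemLp f 2 ν) (hg : Measurable g) (hC : ∀ x, |g x| ≤ C) :
    MemLp (fun x => f x * g x) 2 ν :=
  hf.of_le_mul (c := C) (hf.1.mul hg.aestronglyMeasurable) (ae_of_all _ fun x => by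
    rw [norm_mul, mul_comm]
    exact mul_le_mul_of_nonneg_right (hC x) (norm_nonneg _))

/-- Every term is an `L²` variable or a conditional expectation of one: the weighted outcome, its
projections on `(X, A)` and then on `X`, the derivative term, and its projection on `X`. -/
theorem NumRegular.memLp_phiNum (hK : IsKernel K) (hS : ContDiff ℝ 2 (fun p => S p t))
    (hL : ∀ p, |dS S t p| ≤ L) {P : ProbabilityMeasure (Obs 𝒳)} {π μ : 𝒳 → ℝ → ℝ}
    (hr : NumRegular K h a S t P π) (hπ : IsTreatmentDensity P π)
    (hμ : IsOutcomeRegression P μ) :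
    MemLp (phiNum K h a S t π μ) 2 (P : Measure (Obs 𝒳)) := by
  have mk : Measurable (fun w : 𝒳 × ℝ => scaledKernel K h (w.2 - a)) := hK.measurable_scaledKernel
  have mS : Measurable (fun w : 𝒳 × ℝ => S (π w.1 w.2) t) :=
    hS.continuous.measurable.comp hπ.measurable
  have mD : Measurable (fun w : 𝒳 × ℝ => dS S t (π w.1 w.2)) :=
    (continuous_dS hS).measurable.comp hπ.measurable
  have mF : Measurable (fun w : 𝒳 × ℝ => scaledKernel K h (w.2 - a) * S (π w.1 w.2) t /
      π w.1 w.2) := (mk.mul mS).div hπ.measurable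
  obtain ⟨B, -, hB⟩ := hK.exists_abs_scaledKernel_le (h := h)
  have l1 : MemLp (fun z : Obs 𝒳 => scaledKernel K h (z.2.1 - a) * S (π z.1 z.2.1) t /
      π z.1 z.2.1 * z.2.2) 2 (P : Measure (Obs 𝒳)) :=
    (memLp_congr_ae (ae_of_all _ fun z => by ring)).1 hr.weighted_memLp
  have l2 := hμ.memLp_mul mF l1
  have l3 := hπ.memLp_integral (mF.fun_mul hμ.measurable) l2
  have lk : MemLp (fun z : Obs 𝒳 => scaledKernel K h (z.2.1 - a) * z.2.2) 2
      (P : Measure (Obs 𝒳)) :=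
    (memLp_congr_ae (ae_of_all _ fun z => by simp only [outcome, Function.comp, covTreat]; ring)).1
      (memLp_mul_of_abs_le hr.outcome_memLp (mk.comp measurable_covTreat) (fun z => hB _))
  have l4 : MemLp (fun z : Obs 𝒳 => scaledKernel K h (z.2.1 - a) * μ z.1 z.2.1 *
      dS S t (π z.1 z.2.1)) 2 (P : Measure (Obs 𝒳)) :=
    memLp_mul_of_abs_le (hμ.memLp_mul mk lk) (mD.comp measurable_covTreat) (fun z => hL _)
  have l5 := hπ.memLp_integral ((mk.fun_mul hμ.measurable).fun_mul mD) l4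
  have hpos := Measure.ae_ae_of_ae_prod ((ae_kernelMeasure_iff hK).1 hr.positivity)
  have hpos' : ∀ᵐ z ∂(P : Measure (Obs 𝒳)), ∀ᵐ a₀ : ℝ,
      scaledKernel K h (a₀ - a) ≠ 0 → 0 < π z.1 a₀ :=
    ae_of_ae_map measurable_fst.aemeasurable hpos
  refine (memLp_congr_ae ?_).1 (((l1.sub l2).add l3).add l4 |>.sub l5)
  filter_upwards [hpos'] with z hz
  have e3 : ∫ a₀, π z.1 a₀ * (scaledKernel K h (a₀ - a) * S (π z.1 a₀) t / π z.1 a₀ * μ z.1 a₀) =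
      ∫ a₀, scaledKernel K h (a₀ - a) * S (π z.1 a₀) t * μ z.1 a₀ := by
    refine integral_congr_ae ?_
    filter_upwards [hz] with a₀ ha
    by_cases h0 : scaledKernel K h (a₀ - a) = 0
    · simp [h0]
    · have := (ha h0).ne'
      field_simp
  have e5 : ∫ a₀, π z.1 a₀ * (scaledKernel K h (a₀ - a) * μ z.1 a₀ * dS S t (π z.1 a₀)) =
      ∫ a₀, scaledKernel K h (a₀ - a) * μ z.1 a₀ * dS S t (π z.1 a₀) * π z.1 a₀ := by
    congr 1
    ext a₀
    ring
  simp only [Pi.add_apply, Pi.sub_apply]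
  rw [phiNum_apply, e3, e5]
  ring

/-- The function is in fact bounded: `|S(π)| ≤ |S(0)| + L π` and `∫ π(a₀|x) da₀ = 1` for every `x`.
The three terms involving `π` or the derivative cost `B * L` each. -/
theorem IsPropensityScore.memLp_phiDen (hK : IsKernel K) (hh : 0 < h)
    (hS : ContDiff ℝ 2 (fun p => S p t)) (hL : ∀ p, |dS S t p| ≤ L)
    {P : ProbabilityMeasure (Obs 𝒳)} {π : 𝒳 → ℝ → ℝ} (hπ : IsPropensityScore P π) :
    MemLp (phiDen K h a S t π) 2 (P : Measure (Obs 𝒳)) := by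
  have hL0 : 0 ≤ L := (abs_nonneg _).trans (hL 0)
  have mk : Measurable (fun w : 𝒳 × ℝ => scaledKernel K h (w.2 - a)) := hK.measurable_scaledKernel
  obtain ⟨B, hB0, hB⟩ := hK.exists_abs_scaledKernel_le (h := h)
  have hφ := (integrable_phiDen_and_integral (a := a) hK hh hS hL hπ.isTreatmentDensity
    hπ.measurable (hπ.integrable_kernel_mul hK)).1
  have hk := hK.integrable_scaledKernel (a := a) hh
  have hp : ∀ x, Integrable (fun a₀ => π x a₀) := fun x =>
    ⟨(hπ.measurable.comp measurable_prodMk_left).aestronglyMeasurable, by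
      rw [hasFiniteIntegral_iff_ofReal (ae_of_all _ fun a₀ => hπ.nonneg x a₀)]
      simp [hπ.lintegral_eq_one]⟩
  have hp1 : ∀ x, ∫ a₀, π x a₀ = 1 := fun x => by
    rw [integral_eq_lintegral_of_nonneg_ae (ae_of_all _ fun a₀ => hπ.nonneg x a₀) (hp x).1,
      hπ.lintegral_eq_one]
    simp
  refine MemLp.of_bound hφ.1 ((|S 0 t| * ∫ a₀, |scaledKernel K h (a₀ - a)|) + B * L + B * L + B * L)
    (ae_of_all _ fun z => ?_)
  have b1 : |∫ a₀, scaledKernel K h (a₀ - a) * S (π z.1 a₀) t| ≤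
      (|S 0 t| * ∫ a₀, |scaledKernel K h (a₀ - a)|) + B * L := by
    have hi : Integrable (fun a₀ => |S 0 t| * |scaledKernel K h (a₀ - a)| + B * L * π z.1 a₀) :=
      (hk.abs.const_mul _).fun_add ((hp z.1).const_mul _)
    have := norm_integral_le_of_norm_le hi
      (f := fun a₀ => scaledKernel K h (a₀ - a) * S (π z.1 a₀) t) (ae_of_all _ fun a₀ => by
        have h1 := abs_sub_le_of_abs_dS_le hS hL (π z.1 a₀) 0
        rw [sub_zero, abs_of_nonneg (hπ.nonneg z.1 a₀)] at h1
        have h2 := abs_sub_abs_le_abs_sub (S (π z.1 a₀) t) (S 0 t)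
        have h3 : |S (π z.1 a₀) t| ≤ |S 0 t| + L * π z.1 a₀ := by linarith
        have h4 := mul_le_mul_of_nonneg_left h3 (abs_nonneg (scaledKernel K h (a₀ - a)))
        have h5 := mul_le_mul_of_nonneg_right (hB (a₀ - a))
          (mul_nonneg hL0 (hπ.nonneg z.1 a₀))
        rw [Real.norm_eq_abs, abs_mul]
        linarith)
    rwa [integral_add (hk.abs.const_mul _) ((hp z.1).const_mul _), integral_const_mul,
      integral_const_mul, hp1, mul_one] at this
  have b2 : |scaledKernel K h (z.2.1 - a) * dS S t (π z.1 z.2.1)| ≤ B * L := by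
    rw [abs_mul]
    exact mul_le_mul (hB _) (hL _) (abs_nonneg _) hB0
  have b3 : |∫ a₀, scaledKernel K h (a₀ - a) * dS S t (π z.1 a₀) * π z.1 a₀| ≤ B * L := by
    have := norm_integral_le_of_norm_le ((hp z.1).const_mul (B * L))
      (f := fun a₀ => scaledKernel K h (a₀ - a) * dS S t (π z.1 a₀) * π z.1 a₀)
      (ae_of_all _ fun a₀ => by
        rw [Real.norm_eq_abs, abs_mul, abs_mul, abs_of_nonneg (hπ.nonneg z.1 a₀)]
        exact mul_le_mul_of_nonneg_right
          (mul_le_mul (hB _) (hL _) (abs_nonneg _) hB0) (hπ.nonneg z.1 a₀))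
    rwa [integral_const_mul, hp1, mul_one] at this
  rw [phiDen_apply, Real.norm_eq_abs]
  refine (abs_sub _ _).trans ?_
  have := abs_add_le (∫ a₀, scaledKernel K h (a₀ - a) * S (π z.1 a₀) t)
    (scaledKernel K h (z.2.1 - a) * dS S t (π z.1 z.2.1))
  linarith

theorem isUncenteredEIF_phiNum (hK : IsKernel K) (hS : ContDiff ℝ 2 (fun p => S p t))
    (hL : ∀ p, |dS S t p| ≤ L) {P : ProbabilityMeasure (Obs 𝒳)} {π μ : 𝒳 → ℝ → ℝ}
    (hπ : IsTreatmentDensity P π) (hμ : IsOutcomeRegression P μ)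
    (hr : NumRegular K h a S t P π) :
    IsUncenteredEIF (psiNum K h a S t) P (phiNum K h a S t π μ) := by
  refine (isInfluenceFunction_of_remainder (hr.memLp_phiNum hK hS hL hπ hμ)
    (hr.integral_phiNum hK hS hL hπ hμ) fun Q r M hM hT => ?_).isEfficientIF
  have mk : Measurable (fun w : 𝒳 × ℝ => scaledKernel K h (w.2 - a)) := hK.measurable_scaledKernel
  have hD := isLittleO_integral_taylorR2 hM hS hL hπ hT (mk.fun_mul hμ.measurable)
    ((hπ.integrable_iff (mk.fun_mul hμ.measurable)).1
      (hr.crossIntegrable_self hK hS hπ hμ).regression)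
  have hsq : ∀ C : ℝ, (fun s : ℝ => (M * |s|) ^ 2 * C) =o[𝓝 0] fun s => s := fun C => by
    have : (fun s : ℝ => s ^ 2) =o[𝓝 0] fun s => s := by
      simpa using Asymptotics.isLittleO_pow_pow (𝕜 := ℝ) (m := 1) (n := 2) (by norm_num)
    refine (this.const_mul_left (M ^ 2 * C)).congr_left fun s => ?_
    rw [mul_pow, sq_abs]
    ring
  -- The constant depends only on `P` and not on `s`, so the regression errors contribute `O(s²)`.
  obtain ⟨C, hC⟩ : ∃ C : ℝ, ∀ᶠ s in 𝓝 (0 : ℝ),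
      |∫ z, phiNum K h a S t π μ z ∂(Q s : Measure (Obs 𝒳)) - psiNum K h a S t (Q s)| ≤
        (M * |s|) ^ 2 * C + 2 * ∫ w : 𝒳 × ℝ, |scaledKernel K h (w.2 - a) * μ w.1 w.2| *
          |taylorR2 S t (π w.1 w.2) (propScore (Q s) w.1 w.2)| ∂(baseMeasure P) :=
    ⟨_, hT.mono fun s hs =>
      hs.1.abs_integral_phiNum_sub_le hK hS hL (by positivity) hs.2 hπ hμ hr⟩
  refine Asymptotics.IsBigO.trans_isLittleO (Asymptotics.IsBigO.of_bound' ?_)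
    ((hsq C).add (hD.const_mul_left 2))
  filter_upwards [hC] with s hs
  rw [Real.norm_eq_abs, Real.norm_eq_abs]
  exact hs.trans (le_abs_self _)

theorem isUncenteredEIF_phiDen (hK : IsKernel K) (hh : 0 < h)
    (hS : ContDiff ℝ 2 (fun p => S p t))
    (hL : ∀ p, |dS S t p| ≤ L) {P : ProbabilityMeasure (Obs 𝒳)} {π : 𝒳 → ℝ → ℝ}
    (hπ : IsPropensityScore P π) :
    IsUncenteredEIF (psiDen K h a S t) P (phiDen K h a S t π) := by
  refine (isInfluenceFunction_of_remainder (hπ.memLp_phiDen hK hh hS hL)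
    (hπ.isTreatmentDensity.integral_phiDen hK hh hS hL) fun Q r M hM hT => ?_).isEfficientIF
  have mk : Measurable (fun w : 𝒳 × ℝ => scaledKernel K h (w.2 - a)) := hK.measurable_scaledKernel
  have hD := isLittleO_integral_taylorR2 hM hS hL hπ.isTreatmentDensity hT mk
    ((hπ.integrable_kernel_mul hK).congr (ae_of_all _ fun w => by ring))
  refine Asymptotics.IsBigO.trans_isLittleO (Asymptotics.IsBigO.of_bound' ?_)
    (hD.const_mul_left 2)
  filter_upwards [hT] with s hs
  rw [Real.norm_eq_abs, Real.norm_eq_abs]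
  exact (hs.1.abs_integral_phiDen_sub_le hK hh hS hL (by positivity) hs.2
    hπ.isTreatmentDensity).trans (le_abs_self _)

end

end TrimmedEffect

end

theorem theorem1 {𝒳 : Type*} [MeasurableSpace 𝒳]
    (K : ℝ → ℝ) (hK : TrimmedEffect.IsKernel K) (h : ℝ) (hh : 0 < h) (a : ℝ)
    (S : ℝ → ℝ → ℝ) (t : ℝ) (hS : ContDiff ℝ 2 (fun p => S p t))
    (L : ℝ) (hL : ∀ p, |TrimmedEffect.dS S t p| ≤ L) :
    -- the uncentered efficient influence function of the numerator
    (∀ (P : ProbabilityMeasure (TrimmedEffect.Obs 𝒳)) (π μ : 𝒳 → ℝ → ℝ),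
      TrimmedEffect.IsPropensityScore P π → TrimmedEffect.IsOutcomeRegression P μ →
      TrimmedEffect.NumRegular K h a S t P π →
      TrimmedEffect.IsUncenteredEIF (TrimmedEffect.psiNum K h a S t) P
        (TrimmedEffect.phiNum K h a S t π μ)) ∧
    -- the uncentered efficient influence function of the denominator
    (∀ (P : ProbabilityMeasure (TrimmedEffect.Obs 𝒳)) (π : 𝒳 → ℝ → ℝ),
      TrimmedEffect.IsPropensityScore P π →
      TrimmedEffect.IsUncenteredEIF (TrimmedEffect.psiDen K h a S t) P
        (TrimmedEffect.phiDen K h a S t π)) ∧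
    -- the von Mises expansion of the numerator and its second-order remainder
    (∀ (P P' : ProbabilityMeasure (TrimmedEffect.Obs 𝒳)) (π μ π' μ' : 𝒳 → ℝ → ℝ),
      TrimmedEffect.IsPropensityScore P π → TrimmedEffect.IsOutcomeRegression P μ →
      TrimmedEffect.NumRegular K h a S t P π →
      TrimmedEffect.IsPropensityScore P' π' → TrimmedEffect.IsOutcomeRegression P' μ' →
      TrimmedEffect.NumRegular K h a S t P' π' →
      TrimmedEffect.CrossIntegrable K h a S t P μ π' μ' →
      Integrable (TrimmedEffect.phiNum K h a S t π' μ')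
        (P : Measure (TrimmedEffect.Obs 𝒳)) ∧
      TrimmedEffect.psiNum K h a S t P' - TrimmedEffect.psiNum K h a S t P =
        ((∫ z, (TrimmedEffect.phiNum K h a S t π' μ' z - TrimmedEffect.psiNum K h a S t P')
            ∂(P' : Measure (TrimmedEffect.Obs 𝒳)))
          - ∫ z, (TrimmedEffect.phiNum K h a S t π' μ' z - TrimmedEffect.psiNum K h a S t P')
            ∂(P : Measure (TrimmedEffect.Obs 𝒳)))
        + TrimmedEffect.remNum K h a S t P π μ π' μ' ∧
      ∀ c B M : ℝ, 0 < c →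
        (∀ᵐ w ∂(TrimmedEffect.kernelMeasure K h a P), c ≤ π' w.1 w.2) →
        (∀ᵐ w ∂(TrimmedEffect.kernelMeasure K h a P), |μ w.1 w.2| ≤ M) →
        (∀ p, |TrimmedEffect.ddS S t p| ≤ B) →
        ENNReal.ofReal |TrimmedEffect.remNum K h a S t P π μ π' μ'| ≤
          ENNReal.ofReal (|S 0 t| / c + 2 * L) *
              (TrimmedEffect.kernelDist K h a P π π' * TrimmedEffect.kernelDist K h a P μ μ')
            + ENNReal.ofReal (B * M / 2) * TrimmedEffect.kernelDist K h a P π π' ^ 2) ∧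
    -- the von Mises expansion of the denominator and its second-order remainder
    (∀ (P P' : ProbabilityMeasure (TrimmedEffect.Obs 𝒳)) (π π' : 𝒳 → ℝ → ℝ),
      TrimmedEffect.IsPropensityScore P π → TrimmedEffect.IsPropensityScore P' π' →
      Integrable (TrimmedEffect.phiDen K h a S t π')
        (P : Measure (TrimmedEffect.Obs 𝒳)) ∧
      TrimmedEffect.psiDen K h a S t P' - TrimmedEffect.psiDen K h a S t P =
        ((∫ z, (TrimmedEffect.phiDen K h a S t π' z - TrimmedEffect.psiDen K h a S t P')
            ∂(P' : Measure (TrimmedEffect.Obs 𝒳)))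
          - ∫ z, (TrimmedEffect.phiDen K h a S t π' z - TrimmedEffect.psiDen K h a S t P')
            ∂(P : Measure (TrimmedEffect.Obs 𝒳)))
        + TrimmedEffect.remDen K h a S t P π π' ∧
      ∀ B : ℝ, (∀ p, |TrimmedEffect.ddS S t p| ≤ B) →
        ENNReal.ofReal |TrimmedEffect.remDen K h a S t P π π'| ≤
          ENNReal.ofReal (B / 2) * TrimmedEffect.kernelDist K h a P π π' ^ 2) ∧
    -- the Taylor remainder in the two expansions is of third order
    (∀ B : ℝ, ContDiff ℝ 3 (fun p => S p t) →
      (∀ p, |deriv (TrimmedEffect.ddS S t) p| ≤ B) →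
      ∀ q p : ℝ, |TrimmedEffect.taylorR3 S t q p| ≤ B / 6 * |p - q| ^ 3) := by
  refine ⟨fun P π μ hπ hμ hr =>
    TrimmedEffect.isUncenteredEIF_phiNum hK hS hL hπ.isTreatmentDensity hμ hr,
    fun P π hπ => TrimmedEffect.isUncenteredEIF_phiDen hK hh hS hL hπ, ?_, ?_,
    fun B hS3 hB q p => TrimmedEffect.abs_taylorR3_le hS3 hB q p⟩
  · intro P P' π μ π' μ' hπ hμ hr hπ' hμ' hr' hc
    obtain ⟨hi, hint, iA, iB⟩ := TrimmedEffect.integrable_phiNum_and_integral hK hS hL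
      hπ.isTreatmentDensity hμ hr.positivity hπ'.measurable hμ'.measurable hc
      (hr.integrable_mul_smoothing hK hS hπ.isTreatmentDensity hμ)
    have hi' := (hr'.memLp_phiNum hK hS hL hπ'.isTreatmentDensity hμ').integrable (by norm_num)
    refine ⟨hi, ?_, fun c B M hc0 hc1 hM hB =>
      TrimmedEffect.ofReal_abs_remNum_le hK hS hL hπ.measurable hμ.measurable hπ'.measurable
        hμ'.measurable iA iB hc0 hc1 hM hB⟩
    -- The centred function has mean zero under `P'` and mean `ψ(P) + R₂ - ψ(P')` under `P`.
    rw [integral_sub hi' (integrable_const _), integral_sub hi (integrable_const _), hint,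
      hr'.integral_phiNum hK hS hL hπ'.isTreatmentDensity hμ']
    simp
    ring
  · intro P P' π π' hπ hπ'
    obtain ⟨hi, hint, iB⟩ := TrimmedEffect.integrable_phiDen_and_integral (a := a) hK hh hS hL
      hπ.isTreatmentDensity hπ'.measurable (hπ'.integrable_kernel_mul hK)
    have hi' := (hπ'.memLp_phiDen (a := a) hK hh hS hL).integrable (by norm_num)
    refine ⟨hi, ?_, fun B hB =>
      TrimmedEffect.ofReal_abs_remDen_le hK hS hπ.measurable hπ'.measurable iB hB⟩
    rw [integral_sub hi' (integrable_const _), integral_sub hi (integrable_const _), hint,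
      hπ'.isTreatmentDensity.integral_phiDen hK hh hS hL]
    simp
    ring
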